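/- Let $\mathcal D$ be the standard Engel structure on $\mathbb R^4$ with coordinates $(x,y,z,w)$, i.e. the $2$-plane field defined by $dz-y\,dx=0$ and $dw-z\,dx=0$, which is spanned by $e_1=\partial_x+y\,\partial_z+z\,\partial_w$ and $e_2=\partial_y$. A \emph{horizontal loop} is a smooth ($C^\infty$) embedding $\gamma\colon S^1=\mathbb R/\mathbb Z\to\mathbb R^4$ with $\gamma'(s)\in\mathcal D_{\gamma(s)}$ for all $s$. A \emph{horizontal isotopy} between horizontal loops $\gamma_0,\gamma_1$ is a smooth map $[0,1]\times S^1\to\mathbb R^4$, $(t,s)\mapsto\gamma_t(s)$, starting at $\gamma_0$ and ending at $\gamma_1$, such that every $\gamma_t$ is a horizontal loop. The \emph{rotation number} $\mathtt{rot}(\gamma)\in\mathbb Z$ is the number of complete turns of the velocity vector relative to $e_1,e_2$ as the loop is traversed once in positive direction: if $\theta\colon\mathbb R\to\mathbb R$ is continuous and $\gamma'(s)$ is a positive multiple of $\cos\theta(s)\,e_1+\sin\theta(s)\,e_2$ at $\gamma(s)$ for all $s$, then $\mathtt{rot}(\gamma)=\frac{1}{2\pi}(\theta(1)-\theta(0))$.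 \textbf{Theorem (Adachi).} Two horizontal loops are horizontally isotopic if and only if their rotation numbers agree. Moreover, every integer is the rotation number of some horizontal loop. -/

import Mathlib

open scoped ContDiff

namespace Engel

/-- Euclidean four-space; the coordinates `(x, y, z, w)` are the components `0, 1, 2, 3`. -/
abbrev R4 : Type := EuclideanSpace ℝ (Fin 4)

/-- The vector field `e₁ = ∂_x + y ∂_z + z ∂_w`. -/
noncomputable def e₁ (p : R4) : R4 := !₂[1, 0, p 1, p 2]

/-- The vector field `e₂ = ∂_y`. -/
noncomputable def e₂ (_p : R4) : R4 := !₂[0, 1, 0, 0]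

/-- The standard Engel structure: the plane at `p` cut out of the tangent space by
`dz - y dx = 0` and `dw - z dx = 0`. -/
def distribution (p : R4) : Submodule ℝ R4 where
  carrier := {v | v 2 - p 1 * v 0 = 0 ∧ v 3 - p 2 * v 0 = 0}
  add_mem' := by
    rintro u v ⟨h1, h2⟩ ⟨h3, h4⟩
    simp only [Set.mem_ofPred_eq, PiLp.add_apply]
    constructor <;> linarith
  zero_mem' := by simp
  smul_mem' := by
    rintro c v ⟨h1, h2⟩
    simp only [Set.mem_ofPred_eq, PiLp.smul_apply, smul_eq_mul]
    constructor
    · linear_combination c * h1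
    · linear_combination c * h2

/-- A vector of the plane at `p` is the combination of `e₁, e₂` with coefficients its `x`- and
`y`-components. -/
theorem eq_of_mem_distribution {p v : R4} (h : v ∈ distribution p) :
    v = v 0 • e₁ p + v 1 • e₂ p := by
  obtain ⟨h1, h2⟩ := h
  ext i
  fin_cases i
  · simp [e₁, e₂]
  · simp [e₁, e₂]
  · simp [e₁, e₂]; linarith
  · simp [e₁, e₂]; linarith

/-- The fields `e₁, e₂` span the Engel structure. -/
theorem distribution_eq_span (p : R4) : distribution p = Submodule.span ℝ {e₁ p, e₂ p} := by
  apply le_antisymm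
  · intro v hv
    rw [Submodule.mem_span_pair]
    exact ⟨v 0, v 1, (eq_of_mem_distribution hv).symm⟩
  · rw [Submodule.span_le]
    rintro v (rfl | rfl) <;> constructor <;> simp [e₁, e₂]

/-- The velocity vector of a map from the circle `ℝ / ℤ`, at the parameter `s`. -/
noncomputable def velocity (γ : UnitAddCircle → R4) (s : ℝ) : R4 :=
  deriv (fun u : ℝ => γ (u : UnitAddCircle)) s

/-- A horizontal loop: a smooth embedding (that is, the circle being compact, a smooth injective
immersion) of the circle `ℝ / ℤ` in four-space, everywhere tangent to the Engel structure. -/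
structure HorizontalLoop where
  toFun : UnitAddCircle → R4
  smooth : ContDiff ℝ ∞ (fun s : ℝ => toFun (s : UnitAddCircle))
  injective : Function.Injective toFun
  immersion : ∀ s : ℝ, velocity toFun s ≠ 0
  horizontal : ∀ s : ℝ, velocity toFun s ∈ distribution (toFun (s : UnitAddCircle))

/-- A horizontal isotopy from `γ₀` to `γ₁`: a smooth map on `[0, 1] × S¹` all of whose time-`t`
maps are horizontal loops, equal to `γ₀` for `t = 0` and to `γ₁` for `t = 1`. (The values
`Γ t` with `t` outside `[0, 1]` play no role.) -/
def HorizontallyIsotopic (γ₀ γ₁ : HorizontalLoop) : Prop :=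
  ∃ Γ : ℝ → HorizontalLoop,
    ContDiffOn ℝ ∞ (fun p : ℝ × ℝ => (Γ p.1).toFun (p.2 : UnitAddCircle))
      (Set.Icc (0 : ℝ) 1 ×ˢ Set.univ) ∧
    Γ 0 = γ₀ ∧ Γ 1 = γ₁

/-- `θ` is a continuous choice of the angle of the velocity vector of `γ` in the frame
`e₁, e₂` of the Engel structure. -/
def IsAngle (γ : HorizontalLoop) (θ : ℝ → ℝ) : Prop :=
  Continuous θ ∧ ∀ s : ℝ, ∃ ρ : ℝ, 0 < ρ ∧
    velocity γ.toFun s =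
      ρ • (Real.cos (θ s) • e₁ (γ.toFun (s : UnitAddCircle)) +
        Real.sin (θ s) • e₂ (γ.toFun (s : UnitAddCircle)))

/-- The velocity vector makes `n` complete turns as the loop is traversed once. -/
def HasRotationNumber (γ : HorizontalLoop) (n : ℤ) : Prop :=
  ∃ θ : ℝ → ℝ, IsAngle γ θ ∧ θ 1 - θ 0 = 2 * Real.pi * n

theorem velocity_add_one (γ : UnitAddCircle → R4) (s : ℝ) :
    velocity γ (s + 1) = velocity γ s := by
  unfold velocity
  rw [← deriv_comp_add_const]
  congr 1
  funext u
  simp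

/-- Two angles of the same vector differ by a multiple of `2π`. -/
theorem cos_sin_eq_of_smul {p : R4} {a b ρ σ : ℝ} (hρ : 0 < ρ) (hσ : 0 < σ)
    (h : ρ • (Real.cos a • e₁ p + Real.sin a • e₂ p) =
      σ • (Real.cos b • e₁ p + Real.sin b • e₂ p)) :
    ∃ k : ℤ, a - b = 2 * Real.pi * k := by
  have h0 : ρ * Real.cos a = σ * Real.cos b := by
    simpa [e₁, e₂] using congrArg (fun v : R4 => v 0) h
  have h1 : ρ * Real.sin a = σ * Real.sin b := by
    simpa [e₁, e₂] using congrArg (fun v : R4 => v 1) h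
  have hsq : ρ ^ 2 = σ ^ 2 := by
    have ea := Real.sin_sq_add_cos_sq a
    have eb := Real.sin_sq_add_cos_sq b
    calc ρ ^ 2 = (ρ * Real.cos a) ^ 2 + (ρ * Real.sin a) ^ 2 := by
          linear_combination -(ρ ^ 2) * ea
      _ = σ ^ 2 := by rw [h0, h1]; linear_combination σ ^ 2 * eb
  have hρσ : ρ = σ := by
    rcases sq_eq_sq_iff_eq_or_eq_neg.mp hsq with h | h
    · exact h
    · linarith
  subst hρσ
  have hc := mul_left_cancel₀ hρ.ne' h0
  have hs := mul_left_cancel₀ hρ.ne' h1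
  have : Real.cos (a - b) = 1 := by
    rw [Real.cos_sub, hc, hs]
    linear_combination Real.sin_sq_add_cos_sq b
  obtain ⟨k, hk⟩ := (Real.cos_eq_one_iff _).mp this
  exact ⟨k, by linarith⟩

theorem exists_isAngle (γ : HorizontalLoop) : ∃ θ : ℝ → ℝ, IsAngle γ θ := by
  have hv : ContDiff ℝ 1 (velocity γ.toFun) := by
    have h2 : ContDiff ℝ (1 + 1) (fun s : ℝ => γ.toFun (s : UnitAddCircle)) :=
      γ.smooth.of_le (by norm_cast)
    exact (contDiff_succ_iff_deriv.mp h2).2.2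
  have hx : ∀ i : Fin 4, ContDiff ℝ 1 (fun s => velocity γ.toFun s i) := fun i => by
    fun_prop
  let F : ℝ → ℂ := fun s =>
    (velocity γ.toFun s 0 : ℂ) + (velocity γ.toFun s 1 : ℂ) * Complex.I
  have hF : ContDiff ℝ 1 F :=
    (Complex.ofRealCLM.contDiff.comp (hx 0)).add
      ((Complex.ofRealCLM.contDiff.comp (hx 1)).mul contDiff_const)
  have hF0 : ∀ s, F s ≠ 0 := by
    intro s h
    apply γ.immersion s
    have hre : velocity γ.toFun s 0 = 0 := by simpa [F] using congrArg Complex.re h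
    have him : velocity γ.toFun s 1 = 0 := by simpa [F] using congrArg Complex.im h
    rw [eq_of_mem_distribution (γ.horizontal s), hre, him]
    simp
  let g : ℝ → ℂ := fun s => deriv F s / F s
  have hg : Continuous g := (hF.continuous_deriv le_rfl).div hF.continuous hF0
  let L : ℝ → ℂ := fun s => Complex.log (F 0) + ∫ u in (0 : ℝ)..s, g u
  have hL : ∀ s, HasDerivAt L (g s) s := fun s =>
    (intervalIntegral.integral_hasDerivAt_right (hg.intervalIntegrable _ _)
      (hg.stronglyMeasurableAtFilter _ _) hg.continuousAt).const_add _
  have hLc : Continuous L := continuous_iff_continuousAt.mpr fun s => (hL s).continuousAt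
  have hG : ∀ s, HasDerivAt (fun s => F s * Complex.exp (-L s)) 0 s := by
    intro s
    have h1 := (hF.differentiable one_ne_zero s).hasDerivAt.mul (hL s).neg.cexp
    have h2 : deriv F s * Complex.exp (-L s) + F s * (Complex.exp (-L s) * -g s) = 0 := by
      have h3 : F s * g s = deriv F s := mul_div_cancel₀ _ (hF0 s)
      linear_combination -Complex.exp (-L s) * h3
    exact h2 ▸ h1
  have hconst : ∀ s, F s * Complex.exp (-L s) = 1 := by
    intro s
    have := is_const_of_deriv_eq_zero (fun s => (hG s).differentiableAt)
      (fun s => (hG s).deriv) s 0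
    rw [this]
    simp [L, Complex.exp_neg, Complex.exp_log (hF0 0), hF0 0]
  have hFL : ∀ s, F s = Complex.exp (L s) := by
    intro s
    have h := hconst s
    rw [Complex.exp_neg] at h
    exact (mul_inv_eq_one₀ (Complex.exp_ne_zero _)).mp h
  refine ⟨fun s => (L s).im, Complex.continuous_im.comp hLc, fun s =>
    ⟨Real.exp (L s).re, Real.exp_pos _, ?_⟩⟩
  have hre : velocity γ.toFun s 0 = Real.exp (L s).re * Real.cos (L s).im := by
    rw [← Complex.exp_re, ← hFL]; simp [F]
  have him : velocity γ.toFun s 1 = Real.exp (L s).re * Real.sin (L s).im := by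
    rw [← Complex.exp_im, ← hFL]; simp [F]
  conv_lhs => rw [eq_of_mem_distribution (γ.horizontal s), hre, him]
  rw [smul_add, smul_smul, smul_smul]

/-- The rotation number exists and is unique. -/
theorem existsUnique_hasRotationNumber (γ : HorizontalLoop) :
    ∃! n : ℤ, HasRotationNumber γ n := by
  obtain ⟨θ, hθ⟩ := exists_isAngle γ
  have hp : ((1 : ℝ) : UnitAddCircle) = ((0 : ℝ) : UnitAddCircle) := by simp
  obtain ⟨ρ, hρ, h1⟩ := hθ.2 1
  obtain ⟨σ, hσ, h0⟩ := hθ.2 0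
  have hvel : velocity γ.toFun 1 = velocity γ.toFun 0 := by
    simpa using velocity_add_one γ.toFun 0
  rw [hvel, h0, hp] at h1
  obtain ⟨n, hn⟩ := cos_sin_eq_of_smul hρ hσ h1.symm
  refine ⟨n, ⟨θ, hθ, hn⟩, ?_⟩
  rintro m ⟨η, hη, hm⟩
  have hk : ∀ s, ∃ k : ℤ, η s - θ s = 2 * Real.pi * k := by
    intro s
    obtain ⟨ρ, hρ, h1⟩ := hη.2 s
    obtain ⟨σ, hσ, h2⟩ := hθ.2 s
    exact cos_sin_eq_of_smul hρ hσ (h1.symm.trans h2)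
  choose k hk using hk
  have hpi : (2 * Real.pi) ≠ 0 := by positivity
  have hkc : Continuous k := by
    have hr : Continuous fun s => (k s : ℝ) := by
      have : (fun s => (k s : ℝ)) = fun s => (η s - θ s) / (2 * Real.pi) := by
        funext s
        rw [hk s]
        field_simp
      rw [this]
      exact (hη.1.sub hθ.1).div_const _
    exact Int.isClosedEmbedding_coe_real.isEmbedding.continuous_iff.mpr hr
  have hk01 : k 1 = k 0 := PreconnectedSpace.constant inferInstance hkc
  have h1' := hk 1
  have h0' := hk 0
  rw [hk01] at h1'
  have : 2 * Real.pi * (m : ℝ) = 2 * Real.pi * (n : ℝ) := by linarith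
  exact_mod_cast mul_left_cancel₀ hpi this

/-- The rotation number of a horizontal loop: the number of complete turns of the velocity
vector, relative to `e₁, e₂`, as the loop is traversed once in positive direction. -/
noncomputable def rot (γ : HorizontalLoop) : ℤ :=
  (existsUnique_hasRotationNumber γ).choose

/-- The number `rot γ` is the one that `HasRotationNumber` describes. -/
theorem hasRotationNumber_iff (γ : HorizontalLoop) (n : ℤ) :
    HasRotationNumber γ n ↔ rot γ = n := by
  have h := (existsUnique_hasRotationNumber γ).choose_spec
  constructor
  · intro hn
    exact (h.2 n hn).symm
  · rintro rfl
    exact h.1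

end Engel

namespace Engel

open MeasureTheory intervalIntegral Topology Filter Set

universe u

/-! ### Smoothness of parametric integrals -/

/-! In the coordinates x, m₀ = y, m₁ = xy - z, m₂ = x²y - 2xz + 2w the Engel structure reads dm₁ = x
dm₀, dm₂ = x² dm₀ (`lift`, `lowerM`). A horizontal curve is thus determined by its starting point,
by x, and by G = y'. It closes up iff x is periodic and the moments ∫ xᵏ G, k = 0, 1, 2, vanish over
a period; it passes through the same point at a < b iff x(a) = x(b) and the moments over [a, b]
vanish (`IsDouble`). These are four conditions on the three parameters (t, a, b) of a path of loops,
so double points can be perturbed away. What remains is the homotopy theory of the velocity C + iG,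
C = x', as a loop in ℂ without 0 subject to ∫ C = 0.

The rotation number is the degree of C + iG, which is constant in continuous families; this gives
the invariance. Conversely, loops of velocities of equal degree are joined by a path of such loops
(`IsFrame.smoothlyJoined`): interpolate logarithms, keeping the real part of the exponential of both
signs, and then restore mean zero of the real part with a positive weight (`balance`).

Such a path is turned into a path of embedded loops by `IsFamily.exists_embedded`. Adding C² q(X) to
G, with q a quadratic polynomial, makes the moments vanish, because the Gram matrix of 1, X, X² with
weight C² is invertible for nonconstant X. Changes of G that vanish where C does affect neither the
nonvanishing of C + iG nor its degree. Double points are removed by similar changes of G multiplied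
by bump functions. Where these act invertibly on the moments, a small generic coefficient vector
works: a null set of triples with X(t, a) = X(t, b) can spoil only a null set of coefficients
(`null_setOf_solvable`). Elsewhere double points are excluded stably (`IsStable`). The set of
triples is made null beforehand by adding a small multiple of a sine to X. A factor β(t) keeps the
given ends of the path fixed.

Every integer occurs because the same perturbation applies to a constant family with an explicit
velocity of the given degree. -/

theorem hasFDerivAt_integral_unitInterval {H E : Type u} [NormedAddCommGroup H] [NormedSpace ℝ H]
    [NormedAddCommGroup E] [NormedSpace ℝ E] {f : H × ℝ → E} (hf : ContDiff ℝ 1 f) (x₀ : H) :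
    HasFDerivAt (fun x => ∫ t in (0 : ℝ)..1, f (x, t))
      (∫ t in (0 : ℝ)..1, (fderiv ℝ f (x₀, t)).comp (ContinuousLinearMap.inl ℝ H ℝ)) x₀ := by
  obtain ⟨D, hD⟩ : ∃ D : H × ℝ → H →L[ℝ] E,
      D = fun p => (fderiv ℝ f p).comp (ContinuousLinearMap.inl ℝ H ℝ) := ⟨_, rfl⟩
  have hd : Continuous D := by
    rw [hD]
    exact (hf.continuous_fderiv one_ne_zero).clm_comp continuous_const
  have hder : ∀ x t, HasFDerivAt (fun x => f (x, t)) (D (x, t)) x := by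
    intro x t
    rw [hD]
    exact ((hf.differentiable one_ne_zero (x, t)).hasFDerivAt).comp x
      (hasFDerivAt_prodMk_left x t)
  have hDx : ∀ x, Continuous fun t : ℝ => D (x, t) := fun x => hd.comp (by fun_prop)
  have hfx : ∀ x, Continuous fun t : ℝ => f (x, t) := fun x => hf.continuous.comp (by fun_prop)
  have hgoal : (∫ t in (0 : ℝ)..1, (fderiv ℝ f (x₀, t)).comp (ContinuousLinearMap.inl ℝ H ℝ)) =
      ∫ t in (0 : ℝ)..1, D (x₀, t) := by rw [hD]
  rw [hgoal]
  clear hD hgoal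
  obtain ⟨K, hK⟩ := (isCompact_Icc (a := (0 : ℝ)) (b := 1)).exists_bound_of_continuousOn
    (hDx x₀).continuousOn
  -- Compactness of the unit interval makes the bound at `x₀` uniform near `x₀`, up to the extra 1;
  -- it serves as the dominating constant.
  have hev : ∀ᶠ x in 𝓝 x₀, ∀ t ∈ Icc (0 : ℝ) 1, ‖D (x, t)‖ < K + 1 := by
    refine isCompact_Icc.eventually_forall_of_forall_eventually fun t ht => ?_
    exact hd.norm.continuousAt.eventually (gt_mem_nhds (lt_of_le_of_lt (hK t ht) (lt_add_one K)))
  refine hasFDerivAt_integral_of_dominated_of_fderiv_le (F := fun x t => f (x, t))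
    (F' := fun x t => D (x, t)) (bound := fun _ => K + 1) hev
    (Eventually.of_forall fun x => (hfx x).aestronglyMeasurable)
    ((hfx x₀).intervalIntegrable _ _) (hDx x₀).aestronglyMeasurable ?_
    (continuous_const.intervalIntegrable _ _) (Eventually.of_forall fun t _ x _ => hder x t)
  refine Eventually.of_forall fun t ht x hx => (hx t ?_).le
  rw [uIoc_of_le zero_le_one] at ht
  exact ⟨ht.1.le, ht.2⟩

/-- Induction by differentiating under the integral. The spaces are quantified inside the induction,
and share a universe, because the derivative takes values in `H →L[ℝ] E`. -/
theorem contDiff_integral_unitInterval_nat (n : ℕ) : ∀ {H E : Type u} [NormedAddCommGroup H]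
    [NormedSpace ℝ H] [NormedAddCommGroup E] [NormedSpace ℝ E] {f : H × ℝ → E},
    ContDiff ℝ n f → ContDiff ℝ n (fun x => ∫ t in (0 : ℝ)..1, f (x, t)) := by
  induction n with
  | zero =>
    intro H E _ _ _ _ f hf
    have hc : Continuous f := hf.continuous
    exact contDiff_zero.mpr (continuous_parametric_intervalIntegral_of_continuous'
      (f := fun x t => f (x, t)) hc 0 1)
  | succ n ih =>
    intro H E _ _ _ _ f hf
    have hf1 : ContDiff ℝ 1 f := hf.of_le (by norm_cast; omega)
    push_cast
    rw [contDiff_succ_iff_hasFDerivAt]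
    refine ⟨_, ?_, hasFDerivAt_integral_unitInterval hf1⟩
    refine ih (f := fun p : H × ℝ => (fderiv ℝ f p).comp (ContinuousLinearMap.inl ℝ H ℝ)) ?_
    exact (hf.fderiv_right (by norm_cast)).clm_comp contDiff_const

/-- An integral of a smooth function between smooth bounds depends smoothly on parameters. -/
theorem contDiff_intervalIntegral {H E : Type u} [NormedAddCommGroup H] [NormedSpace ℝ H]
    [NormedAddCommGroup E] [NormedSpace ℝ E] {f : H × ℝ → E} {a b : H → ℝ}
    (hf : ContDiff ℝ ∞ f) (ha : ContDiff ℝ ∞ a) (hb : ContDiff ℝ ∞ b) :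
    ContDiff ℝ ∞ (fun x => ∫ t in a x..b x, f (x, t)) := by
  have h : (fun x => ∫ t in a x..b x, f (x, t)) =
      fun x => ∫ τ in (0 : ℝ)..1, (b x - a x) • f (x, (b x - a x) * τ + a x) := by
    funext x
    rw [intervalIntegral.integral_smul,
      intervalIntegral.smul_integral_comp_mul_add (fun t => f (x, t))]
    congr 1 <;> ring
  rw [h, contDiff_infty]
  intro n
  refine contDiff_integral_unitInterval_nat n
    (f := fun p : H × ℝ => (b p.1 - a p.1) • f (p.1, (b p.1 - a p.1) * p.2 + a p.1)) ?_
  refine ContDiff.of_le ?_ (by exact_mod_cast le_top : (n : WithTop ℕ∞) ≤ ∞)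
  fun_prop

theorem contDiff_integral_unitInterval {f : ℝ × ℝ → ℝ} (hf : ContDiff ℝ ∞ f) :
    ContDiff ℝ ∞ (fun t => ∫ s in (0 : ℝ)..1, f (t, s)) :=
  contDiff_intervalIntegral hf contDiff_const contDiff_const

/-! ### Smoothness of inverse matrices -/

theorem contDiff_det {E : Type*} [NormedAddCommGroup E] [NormedSpace ℝ E] {n : ℕ}
    {A : E → Matrix (Fin n) (Fin n) ℝ} (hA : ∀ i j, ContDiff ℝ ∞ fun x => A x i j) :
    ContDiff ℝ ∞ fun x => (A x).det := by
  simp only [Matrix.det_apply']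
  exact ContDiff.sum fun σ _ => contDiff_const.mul (contDiff_prod fun i _ => hA _ _)

theorem contDiff_adjugate {E : Type*} [NormedAddCommGroup E] [NormedSpace ℝ E] {n : ℕ}
    {A : E → Matrix (Fin n) (Fin n) ℝ} (hA : ∀ i j, ContDiff ℝ ∞ fun x => A x i j)
    (i j : Fin n) : ContDiff ℝ ∞ fun x => (A x).adjugate i j := by
  simp only [Matrix.adjugate_apply]
  refine contDiff_det fun k l => ?_
  by_cases h : k = j
  · subst h; simpa using contDiff_const
  · simpa [Matrix.updateRow_ne h] using hA k l

theorem contDiffAt_inv_apply {E : Type*} [NormedAddCommGroup E] [NormedSpace ℝ E] {n : ℕ}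
    {A : E → Matrix (Fin n) (Fin n) ℝ} (hA : ∀ i j, ContDiff ℝ ∞ fun x => A x i j)
    {x : E} (hx : (A x).det ≠ 0) (i j : Fin n) :
    ContDiffAt ℝ ∞ (fun x => (A x)⁻¹ i j) x := by
  have h : (fun x => (A x)⁻¹ i j) = fun x => (A x).det⁻¹ * (A x).adjugate i j := by
    funext y
    simp [Matrix.inv_def]
  rw [h]
  exact ((contDiff_det hA).contDiffAt.inv hx).mul (contDiff_adjugate hA i j).contDiffAt

/-! ### Avoiding a null family of affine conditions -/

/-- If `Z` is null, then for almost all `v` the inhomogeneous system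
`M p + ∑ i, A i p *ᵥ v i = 0` has no solution `p ∈ Z` at which `A j p` is invertible. -/
theorem null_setOf_solvable {ι : Type*} [Fintype ι] [DecidableEq ι]
    {M : (Fin 3 → ℝ) → (Fin 3 → ℝ)} {A : ι → (Fin 3 → ℝ) → Matrix (Fin 3) (Fin 3) ℝ}
    (hM : ContDiff ℝ ∞ M) (hA : ∀ i k l, ContDiff ℝ ∞ fun p => A i p k l)
    {Z : Set (Fin 3 → ℝ)} (hZ : volume Z = 0) (j : ι) :
    volume {v : ι → Fin 3 → ℝ | ∃ p ∈ Z, (A j p).det ≠ 0 ∧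
      M p + ∑ i, (A i p).mulVec (v i) = 0} = 0 := by
  -- Slot `j` of `q` stores the point `p`, the other slots the remaining `v i`; `Ψ` replaces `p` by
  -- the value of `v j` that the system forces. The bad `v` lie in the image of a null set under
  -- this differentiable map between spaces of equal dimension.
  let Ψ : (ι → Fin 3 → ℝ) → (ι → Fin 3 → ℝ) := fun q =>
    Function.update q j (-((A j (q j))⁻¹.mulVec
      (M (q j) + ∑ i ∈ Finset.univ.erase j, (A i (q j)).mulVec (q i))))
  let D : Set (ι → Fin 3 → ℝ) := {q | q j ∈ Z ∧ (A j (q j)).det ≠ 0}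
  have hD : volume D = 0 := by
    refine measure_mono_null (t := Function.eval j ⁻¹' Z) (fun q hq => hq.1) ?_
    exact (Measure.quasiMeasurePreserving_eval _ j).preimage_null hZ
  have hev : ∀ i (q : ι → Fin 3 → ℝ), DifferentiableAt ℝ (fun q : ι → Fin 3 → ℝ => q i) q :=
    fun i q => by fun_prop
  have hΨ : DifferentiableOn ℝ Ψ D := by
    intro q hq
    refine DifferentiableAt.differentiableWithinAt ?_
    rw [differentiableAt_pi]
    intro i
    by_cases hi : i = j
    · subst hi
      simp only [Ψ, Function.update_self]
      rw [differentiableAt_pi]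
      intro k
      simp only [Pi.neg_apply, Matrix.mulVec, dotProduct, Pi.add_apply, Finset.sum_apply]
      refine DifferentiableAt.neg (DifferentiableAt.fun_sum fun l _ => DifferentiableAt.mul ?_ ?_)
      · exact ((contDiffAt_inv_apply (hA i) hq.2 k l).differentiableAt (by simp)).comp q (hev i q)
      · refine DifferentiableAt.add ?_ (DifferentiableAt.fun_sum fun m _ =>
          DifferentiableAt.fun_sum fun r _ => DifferentiableAt.mul ?_ (by fun_prop))
        · exact ((contDiff_pi.mp hM l).differentiable (by simp) _).comp q
            (hev i q)
        · exact ((hA m l r).differentiable (by simp) _).comp q (hev i q)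
    · simp only [Ψ, Function.update_of_ne hi]
      fun_prop
  refine measure_mono_null ?_
    (addHaar_image_eq_zero_of_differentiableOn_of_addHaar_eq_zero volume hΨ hD)
  rintro v ⟨p, hp, hdet, hv⟩
  refine ⟨Function.update v j p, ⟨by simpa using hp, by simpa using hdet⟩, ?_⟩
  simp only [Ψ, Function.update_self, Function.update_idem]
  have h1 : ∑ i ∈ Finset.univ.erase j, (A i p).mulVec (Function.update v j p i) =
      ∑ i ∈ Finset.univ.erase j, (A i p).mulVec (v i) :=
    Finset.sum_congr rfl fun i hi => by rw [Function.update_of_ne (Finset.ne_of_mem_erase hi)]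
  rw [h1]
  have h2 : M p + ∑ i ∈ Finset.univ.erase j, (A i p).mulVec (v i) = -(A j p).mulVec (v j) := by
    rw [← Finset.add_sum_erase _ _ (Finset.mem_univ j)] at hv
    rw [eq_neg_iff_add_eq_zero, ← hv]
    abel
  rw [h2, Matrix.mulVec_neg, neg_neg, Matrix.mulVec_mulVec,
    Matrix.nonsing_inv_mul _ (isUnit_iff_ne_zero.mpr hdet), Matrix.one_mulVec,
    Function.update_eq_self]

/-! ### Gram matrices -/

/-- The Gram matrix of `1, x, x²` for the weight `ρ` on the interval from `a` to `b`. -/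
noncomputable def gram (ρ x : ℝ → ℝ) (a b : ℝ) : Matrix (Fin 3) (Fin 3) ℝ :=
  Matrix.of fun i j => ∫ s in a..b, x s ^ (i : ℕ) * (ρ s * x s ^ (j : ℕ))

theorem gram_mulVec {ρ x : ℝ → ℝ} (hρ : Continuous ρ) (hx : Continuous x) (a b : ℝ)
    (v : Fin 3 → ℝ) (i : Fin 3) :
    (gram ρ x a b).mulVec v i =
      ∫ s in a..b, x s ^ (i : ℕ) * (ρ s * ∑ j, v j * x s ^ (j : ℕ)) := by
  simp only [Matrix.mulVec, dotProduct, gram, Matrix.of_apply]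
  rw [show (fun s => x s ^ (i : ℕ) * (ρ s * ∑ j : Fin 3, v j * x s ^ (j : ℕ))) =
    fun s => ∑ j : Fin 3, (x s ^ (i : ℕ) * (ρ s * x s ^ (j : ℕ))) * v j from ?_]
  · rw [intervalIntegral.integral_finsetSum]
    · exact Finset.sum_congr rfl fun j _ => (intervalIntegral.integral_mul_const _ _).symm
    · intro j _
      exact Continuous.intervalIntegrable (by fun_prop) _ _
  · funext s
    rw [Finset.mul_sum, Finset.mul_sum]
    exact Finset.sum_congr rfl fun j _ => by ring

/-- A kernel vector `v` is a quadratic polynomial q with ∫ ρ q(x)² = 0, so q(x) vanishes near `s₀`.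
As x' ≠ 0 there, differentiating and dividing by x' kills the derivatives of q as well, hence all
coefficients. -/
theorem det_gram_ne_zero {ρ x c : ℝ → ℝ} {a b s₀ : ℝ} (hρ : Continuous ρ)
    (hc : Continuous c) (hx : ∀ s, HasDerivAt x (c s) s) (hρ0 : ∀ s, 0 ≤ ρ s)
    (hs₀ : s₀ ∈ Ioo a b) (hρs : 0 < ρ s₀) (hcs : c s₀ ≠ 0) :
    (gram ρ x a b).det ≠ 0 := by
  intro hdet
  have hxc : Continuous x := continuous_iff_continuousAt.mpr fun s => (hx s).continuousAt
  obtain ⟨v, hv0, hv⟩ := Matrix.exists_mulVec_eq_zero_iff.mpr hdet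
  let q : ℝ → ℝ := fun s => ∑ j : Fin 3, v j * x s ^ (j : ℕ)
  have hq : Continuous q := by fun_prop
  have hintegral : ∫ s in a..b, ρ s * q s ^ 2 = 0 := by
    have h1 : dotProduct v ((gram ρ x a b).mulVec v) = 0 := by rw [hv]; simp
    rw [← h1]
    simp only [dotProduct, gram_mulVec hρ hxc]
    simp_rw [← intervalIntegral.integral_const_mul]
    rw [← intervalIntegral.integral_finsetSum]
    · refine intervalIntegral.integral_congr fun s _ => ?_
      simp only [q, sq, Finset.sum_mul, Finset.mul_sum]
      exact Finset.sum_congr rfl fun i _ => Finset.sum_congr rfl fun j _ => by ring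
    · intro j _
      exact Continuous.intervalIntegrable (by fun_prop) _ _
  have hzero : ∀ s ∈ Ioo a b, ρ s * q s ^ 2 = 0 := by
    by_contra! hcon
    obtain ⟨s, hs, hne⟩ := hcon
    have hpos := intervalIntegral.integral_pos (hs.1.trans hs.2)
      (f := fun s => ρ s * q s ^ 2) (by fun_prop)
      (fun s _ => mul_nonneg (hρ0 s) (sq_nonneg _))
      ⟨s, ⟨hs.1.le, hs.2.le⟩, lt_of_le_of_ne (mul_nonneg (hρ0 s) (sq_nonneg _)) hne.symm⟩
    linarith
  have hev : ∀ᶠ s in 𝓝 s₀, q s = 0 ∧ c s ≠ 0 := by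
    filter_upwards [Ioo_mem_nhds hs₀.1 hs₀.2, hρ.continuousAt.eventually (lt_mem_nhds hρs),
      hc.continuousAt.eventually_ne hcs] with s h1 h2 h3
    have := hzero s h1
    exact ⟨by simpa [h2.ne'] using this, h3⟩
  have key : ∀ {p : ℝ → ℝ} {p' : ℝ → ℝ}, (∀ s, HasDerivAt p (p' s * c s) s) →
      (∀ᶠ s in 𝓝 s₀, p s = 0) → ∀ᶠ s in 𝓝 s₀, p' s = 0 := by
    intro p p' hp hp0
    filter_upwards [hp0.eventually_nhds, hev] with s h1 h2
    have h3 : HasDerivAt p 0 s := (hasDerivAt_const s (0 : ℝ)).congr_of_eventuallyEq h1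
    simpa [h2.2] using (hp s).unique h3
  have e0 : ∀ᶠ s in 𝓝 s₀, v 0 + v 1 * x s + v 2 * x s ^ 2 = 0 := by
    filter_upwards [hev] with s hs
    simpa [q, Fin.sum_univ_three] using hs.1
  have e1 : ∀ᶠ s in 𝓝 s₀, v 1 + 2 * v 2 * x s = 0 := by
    refine key (fun s => ?_) e0
    refine HasDerivAt.congr_deriv ((((hx s).const_mul (v 1)).const_add (v 0)).add
      (((hx s).pow 2).const_mul (v 2))) ?_
    push_cast
    ring
  have e2 : ∀ᶠ s in 𝓝 s₀, 2 * v 2 = 0 := by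
    refine key (p := fun s => v 1 + 2 * v 2 * x s) (fun s => ?_) e1
    exact ((hx s).const_mul (2 * v 2)).const_add (v 1)
  have h2 : v 2 = 0 := by simpa using e2.self_of_nhds
  have h1 : v 1 = 0 := by simpa [h2] using e1.self_of_nhds
  have h0 : v 0 = 0 := by simpa [h2, h1] using e0.self_of_nhds
  apply hv0
  ext i
  fin_cases i <;> simp [h0, h1, h2]

/-! ### Families of plane curves -/

/-- A smooth family of pairs of `1`-periodic functions: `X (t, ·)`, with derivative `C (t, ·)`, and
`G (t, ·)`. The pair `(C, G)` does not vanish, and no `X (t, ·)` is constant. -/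
structure IsFamily (X C G : ℝ × ℝ → ℝ) : Prop where
  smoothX : ContDiff ℝ ∞ X
  smoothC : ContDiff ℝ ∞ C
  smoothG : ContDiff ℝ ∞ G
  periodicX : ∀ t s, X (t, s + 1) = X (t, s)
  periodicC : ∀ t s, C (t, s + 1) = C (t, s)
  periodicG : ∀ t s, G (t, s + 1) = G (t, s)
  deriv : ∀ t s, HasDerivAt (fun s => X (t, s)) (C (t, s)) s
  regular : ∀ t s, C (t, s) ≠ 0 ∨ G (t, s) ≠ 0
  nonconst : ∀ t, ∃ s, C (t, s) ≠ 0

/-- The integrals of `r, X r, X² r` over an interval. -/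
noncomputable def moment (X r : ℝ × ℝ → ℝ) (t a b : ℝ) : Fin 3 → ℝ :=
  fun k => ∫ s in a..b, X (t, s) ^ (k : ℕ) * r (t, s)

/-- The curve with `x = X (t, ·)` and derivative `r (t, ·)` of `y` lifts to a horizontal curve with the same
end points over `a` and `b`. -/
def IsDouble (X r : ℝ × ℝ → ℝ) (t a b : ℝ) : Prop :=
  X (t, a) = X (t, b) ∧ moment X r t a b = 0

/-- There are no double points; by periodicity it suffices to look at short intervals. -/
def IsSimple (X r : ℝ × ℝ → ℝ) (t : ℝ) : Prop :=
  ∀ a b, a < b → b ≤ a + 1 / 2 → ¬ IsDouble X r t a b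

/-- The Gram matrix of `1, X, X²` for the weight `C²` over an interval. -/
noncomputable def gramC (X C : ℝ × ℝ → ℝ) (t a b : ℝ) : Matrix (Fin 3) (Fin 3) ℝ :=
  gram (fun s => C (t, s) ^ 2) (fun s => X (t, s)) a b

/-- The solution of the linear system that asks the moments of C² q(X) over a period to cancel those
of `r`. -/
noncomputable def closingCoeff (X C r : ℝ × ℝ → ℝ) (t : ℝ) : Fin 3 → ℝ :=
  -((gramC X C t 0 1)⁻¹.mulVec (moment X r t 0 1))

/-- The modification of `r` by a multiple of `C²` with vanishing moments over a period. -/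
noncomputable def closeUp (X C r : ℝ × ℝ → ℝ) : ℝ × ℝ → ℝ :=
  fun p => r p + C p ^ 2 * ∑ j : Fin 3, closingCoeff X C r p.1 j * X p ^ (j : ℕ)

theorem continuous_slice {f : ℝ × ℝ → ℝ} (hf : ContDiff ℝ ∞ f) (t : ℝ) :
    Continuous fun s => f (t, s) :=
  hf.continuous.comp (by fun_prop)

theorem contDiff_moment {X r : ℝ × ℝ → ℝ} (hX : ContDiff ℝ ∞ X) (hr : ContDiff ℝ ∞ r) :
    ContDiff ℝ ∞ fun p : Fin 3 → ℝ => moment X r (p 0) (p 1) (p 2) := by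
  rw [contDiff_pi]
  intro k
  refine contDiff_intervalIntegral
    (f := fun q : (Fin 3 → ℝ) × ℝ => X (q.1 0, q.2) ^ (k : ℕ) * r (q.1 0, q.2)) ?_ ?_ ?_ <;>
  fun_prop

theorem contDiff_moment_period {X r : ℝ × ℝ → ℝ} (hX : ContDiff ℝ ∞ X) (hr : ContDiff ℝ ∞ r) :
    ContDiff ℝ ∞ fun t : ℝ => moment X r t 0 1 := by
  have h : ContDiff ℝ ∞ fun t : ℝ => (![t, 0, 1] : Fin 3 → ℝ) := by
    rw [contDiff_pi]
    intro i
    fin_cases i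
    · exact contDiff_id
    · exact contDiff_const
    · exact contDiff_const
  exact (contDiff_moment hX hr).comp h

theorem moment_add {X r q : ℝ × ℝ → ℝ} {t : ℝ} (hX : Continuous fun s => X (t, s))
    (hr : Continuous fun s => r (t, s)) (hq : Continuous fun s => q (t, s)) (a b : ℝ) :
    moment X (fun p => r p + q p) t a b = moment X r t a b + moment X q t a b := by
  funext k
  simp only [moment, Pi.add_apply, mul_add]
  exact intervalIntegral.integral_add (((hX.pow _).mul hr).intervalIntegrable _ _)
    (((hX.pow _).mul hq).intervalIntegrable _ _)

theorem moment_add_adjacent {X r : ℝ × ℝ → ℝ} {t : ℝ} (hX : Continuous fun s => X (t, s))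
    (hr : Continuous fun s => r (t, s)) (a b c : ℝ) :
    moment X r t a b + moment X r t b c = moment X r t a c := by
  funext k
  exact intervalIntegral.integral_add_adjacent_intervals
    (((hX.pow _).mul hr).intervalIntegrable _ _) (((hX.pow _).mul hr).intervalIntegrable _ _)

theorem moment_period {X r : ℝ × ℝ → ℝ} {t : ℝ} (hX : ∀ s, X (t, s + 1) = X (t, s))
    (hr : ∀ s, r (t, s + 1) = r (t, s)) (a : ℝ) :
    moment X r t a (a + 1) = moment X r t 0 1 := by
  funext k
  have hp : Function.Periodic (fun s => X (t, s) ^ (k : ℕ) * r (t, s)) 1 := fun s => by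
    simp only [hX, hr]
  simpa [moment] using hp.intervalIntegral_add_eq a 0

theorem apply_add_int {r : ℝ × ℝ → ℝ} {t : ℝ} (hr : ∀ s, r (t, s + 1) = r (t, s)) (s : ℝ)
    (n : ℤ) : r (t, s + n) = r (t, s) := by
  simpa using (show Function.Periodic (fun s => r (t, s)) 1 from hr).int_mul n s

theorem moment_add_int {X r : ℝ × ℝ → ℝ} {t : ℝ} (hX : ∀ s, X (t, s + 1) = X (t, s))
    (hr : ∀ s, r (t, s + 1) = r (t, s)) (a b : ℝ) (n : ℤ) :
    moment X r t (a + n) (b + n) = moment X r t a b := by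
  funext k
  simp only [moment]
  rw [← intervalIntegral.integral_comp_add_right
    (fun s => X (t, s) ^ (k : ℕ) * r (t, s)) (n : ℝ)]
  simp only [apply_add_int hX, apply_add_int hr]

theorem contDiff_gramC {X C : ℝ × ℝ → ℝ} (hX : ContDiff ℝ ∞ X) (hC : ContDiff ℝ ∞ C)
    (i j : Fin 3) : ContDiff ℝ ∞ fun t => gramC X C t 0 1 i j := by
  simp only [gramC, gram, Matrix.of_apply]
  exact contDiff_integral_unitInterval
    (f := fun p => X p ^ (i : ℕ) * (C p ^ 2 * X p ^ (j : ℕ))) (by fun_prop)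

namespace IsFamily

variable {X C G : ℝ × ℝ → ℝ}

theorem exists_ne_zero_Ioo (h : IsFamily X C G) (t a : ℝ) :
    ∃ s ∈ Ioo a (a + 1), C (t, s) ≠ 0 := by
  obtain ⟨s, hs⟩ := h.nonconst t
  have hper : Function.Periodic (fun s => C (t, s)) 1 := h.periodicC t
  obtain ⟨s', hs', he⟩ := hper.exists_mem_Ico zero_lt_one s a
  have hne : C (t, s') ≠ 0 := by simpa [← he] using hs
  have hev : ∀ᶠ σ in 𝓝 s', C (t, σ) ≠ 0 :=
    (continuous_slice h.smoothC t).continuousAt.eventually_ne hne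
  have hev2 : ∀ᶠ σ in 𝓝[>] s', σ ∈ Ioo s' (a + 1) := Ioo_mem_nhdsGT hs'.2
  obtain ⟨σ, h1, h2⟩ := (hev2.and (hev.filter_mono nhdsWithin_le_nhds)).exists
  exact ⟨σ, ⟨lt_of_le_of_lt hs'.1 h1.1, h1.2⟩, h2⟩

theorem det_gramC_ne_zero (h : IsFamily X C G) {t a b s₀ : ℝ} (hs₀ : s₀ ∈ Ioo a b)
    (hc : C (t, s₀) ≠ 0) : (gramC X C t a b).det ≠ 0 :=
  det_gram_ne_zero ((continuous_slice h.smoothC t).pow 2) (continuous_slice h.smoothC t)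
    (h.deriv t) (fun _ => sq_nonneg _) hs₀ (by positivity) hc

theorem det_gramC_period_ne_zero (h : IsFamily X C G) (t : ℝ) :
    (gramC X C t 0 1).det ≠ 0 := by
  obtain ⟨s, hs, hc⟩ := h.exists_ne_zero_Ioo t 0
  rw [zero_add] at hs
  exact h.det_gramC_ne_zero hs hc

theorem contDiff_closingCoeff (h : IsFamily X C G) {r : ℝ × ℝ → ℝ} (hr : ContDiff ℝ ∞ r)
    (j : Fin 3) : ContDiff ℝ ∞ fun t => closingCoeff X C r t j := by
  simp only [closingCoeff, Pi.neg_apply, Matrix.mulVec, dotProduct]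
  refine ContDiff.neg (ContDiff.sum fun i _ => ContDiff.mul ?_ ?_)
  · rw [contDiff_iff_contDiffAt]
    exact fun t => contDiffAt_inv_apply (contDiff_gramC h.smoothX h.smoothC)
      (h.det_gramC_period_ne_zero t) j i
  · exact contDiff_pi.mp (contDiff_moment_period h.smoothX hr) i

theorem contDiff_closeUp (h : IsFamily X C G) {r : ℝ × ℝ → ℝ} (hr : ContDiff ℝ ∞ r) :
    ContDiff ℝ ∞ (closeUp X C r) := by
  have hX := h.smoothX
  have hC := h.smoothC
  refine hr.add ((hC.pow 2).mul (ContDiff.sum fun j _ => ContDiff.mul ?_ (hX.pow _)))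
  exact (h.contDiff_closingCoeff hr j).comp contDiff_fst

theorem closeUp_periodic (h : IsFamily X C G) {r : ℝ × ℝ → ℝ}
    (hr : ∀ t s, r (t, s + 1) = r (t, s)) (t s : ℝ) :
    closeUp X C r (t, s + 1) = closeUp X C r (t, s) := by
  simp only [closeUp, hr, h.periodicC, h.periodicX]

theorem moment_closeUp (h : IsFamily X C G) {r : ℝ × ℝ → ℝ} (hr : ContDiff ℝ ∞ r)
    (t a b : ℝ) : moment X (closeUp X C r) t a b =
      moment X r t a b + (gramC X C t a b).mulVec (closingCoeff X C r t) := by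
  have hX := continuous_slice h.smoothX t
  have hC := continuous_slice h.smoothC t
  have hr' := continuous_slice hr t
  have hcont : Continuous fun s =>
      C (t, s) ^ 2 * ∑ j : Fin 3, closingCoeff X C r t j * X (t, s) ^ (j : ℕ) := by
    refine Continuous.mul (hC.pow 2) (continuous_finsetSum _ fun j _ => ?_)
    exact Continuous.mul continuous_const (hX.pow _)
  unfold closeUp
  rw [moment_add hX hr' hcont]
  congr 1
  funext k
  exact (gram_mulVec (ρ := fun s => C (t, s) ^ 2) (hC.pow 2) hX a b (closingCoeff X C r t) k).symm

theorem moment_closeUp_period (h : IsFamily X C G) {r : ℝ × ℝ → ℝ} (hr : ContDiff ℝ ∞ r)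
    (t : ℝ) : moment X (closeUp X C r) t 0 1 = 0 := by
  rw [h.moment_closeUp hr, closingCoeff, Matrix.mulVec_neg, Matrix.mulVec_mulVec,
    Matrix.mul_nonsing_inv _ (isUnit_iff_ne_zero.mpr (h.det_gramC_period_ne_zero t)),
    Matrix.one_mulVec, add_neg_cancel]

end IsFamily

theorem closeUp_of_moment_eq_zero {X C r : ℝ × ℝ → ℝ} {t : ℝ} (h : moment X r t 0 1 = 0)
    (s : ℝ) : closeUp X C r (t, s) = r (t, s) := by
  simp [closeUp, closingCoeff, h]

theorem closeUp_of_eq_zero {X C r : ℝ × ℝ → ℝ} {p : ℝ × ℝ} (h : C p = 0) :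
    closeUp X C r p = r p := by
  simp [closeUp, h]

/-- This is why G is only ever changed by multiples of C: the velocity stays nonzero however large
the change. -/
theorem IsFamily.of_eq_of_eq_zero {X C G G' : ℝ × ℝ → ℝ} (h : IsFamily X C G)
    (hG' : ContDiff ℝ ∞ G') (hper : ∀ t s, G' (t, s + 1) = G' (t, s))
    (heq : ∀ p, C p = 0 → G' p = G p) : IsFamily X C G' where
  __ := h
  smoothG := hG'
  periodicG := hper
  regular t s := by
    by_cases hc : C (t, s) = 0
    · right
      rw [heq _ hc]
      exact (h.regular t s).resolve_left (not_not.mpr hc)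
    · exact Or.inl hc

/-! ### Perturbations supported on an arc -/

/-- A smooth `1`-periodic function that is positive exactly on the arc from `a` to `b`. -/
noncomputable def arcBump (a b : ℝ) (s : ℝ) : ℝ :=
  expNegInvGlue (Real.cos (2 * Real.pi * (s - (a + b) / 2)) - Real.cos (Real.pi * (b - a)))

theorem contDiff_arcBump (a b : ℝ) : ContDiff ℝ ∞ (arcBump a b) :=
  expNegInvGlue.contDiff.comp (by fun_prop)

theorem arcBump_add_one (a b s : ℝ) : arcBump a b (s + 1) = arcBump a b s := by
  unfold arcBump
  rw [show 2 * Real.pi * (s + 1 - (a + b) / 2) =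
    2 * Real.pi * (s - (a + b) / 2) + 2 * Real.pi by ring, Real.cos_add_two_pi]

theorem arcBump_nonneg (a b s : ℝ) : 0 ≤ arcBump a b s := expNegInvGlue.nonneg _

theorem arcBump_pos {a b s : ℝ} (hs : s ∈ Ioo a b) (hab : b ≤ a + 1 / 2) :
    0 < arcBump a b s := by
  refine expNegInvGlue.pos_of_pos (sub_pos.mpr ?_)
  have hpi := Real.pi_pos
  rw [← Real.cos_abs (2 * Real.pi * (s - (a + b) / 2))]
  refine Real.cos_lt_cos_of_nonneg_of_le_pi (abs_nonneg _) (by nlinarith) ?_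
  rw [abs_lt]
  constructor <;> nlinarith [hs.1, hs.2]

theorem arcBump_eq_zero {a b s : ℝ} (hs : s ∈ Icc b (a + 1)) (hab : a ≤ b) :
    arcBump a b s = 0 := by
  refine expNegInvGlue.zero_of_nonpos (sub_nonpos.mpr ?_)
  have hpi := Real.pi_pos
  have key : ∀ y, Real.pi * (b - a) ≤ y → y ≤ Real.pi → Real.cos y ≤ Real.cos (Real.pi * (b - a)) :=
    fun y h1 h2 => Real.cos_le_cos_of_nonneg_of_le_pi
      (mul_nonneg hpi.le (sub_nonneg.mpr hab)) h2 h1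
  rcases le_total (2 * Real.pi * (s - (a + b) / 2)) Real.pi with h | h
  · exact key _ (by nlinarith [hs.1]) h
  · rw [← Real.cos_two_pi_sub]
    exact key _ (by nlinarith [hs.2]) (by linarith)

/-- The perturbation of `G` attached to the bump function `φ` and the index `i`. -/
noncomputable def bumpDirection (X C : ℝ × ℝ → ℝ) (φ : ℝ → ℝ) (i : Fin 3) : ℝ × ℝ → ℝ :=
  closeUp X C (fun p => φ p.2 * C p ^ 2 * X p ^ (i : ℕ))

/-- The effect of the perturbations attached to `φ` on the moments over an interval. -/
noncomputable def bumpMatrix (X C : ℝ × ℝ → ℝ) (β φ : ℝ → ℝ) (p : Fin 3 → ℝ) :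
    Matrix (Fin 3) (Fin 3) ℝ :=
  Matrix.of fun k i => β (p 0) * moment X (bumpDirection X C φ i) (p 0) (p 1) (p 2) k

namespace IsFamily

variable {X C G : ℝ × ℝ → ℝ}

theorem contDiff_bumpDirection (h : IsFamily X C G) {φ : ℝ → ℝ} (hφ : ContDiff ℝ ∞ φ)
    (i : Fin 3) : ContDiff ℝ ∞ (bumpDirection X C φ i) := by
  have hX := h.smoothX
  have hC := h.smoothC
  exact h.contDiff_closeUp (by fun_prop)

theorem bumpDirection_periodic (h : IsFamily X C G) {φ : ℝ → ℝ} (hφ : ∀ s, φ (s + 1) = φ s)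
    (i : Fin 3) (t s : ℝ) :
    bumpDirection X C φ i (t, s + 1) = bumpDirection X C φ i (t, s) := by
  refine h.closeUp_periodic (fun t s => ?_) t s
  simp only [hφ, h.periodicC, h.periodicX]

theorem moment_bumpDirection_period (h : IsFamily X C G) {φ : ℝ → ℝ} (hφ : ContDiff ℝ ∞ φ)
    (i : Fin 3) (t : ℝ) : moment X (bumpDirection X C φ i) t 0 1 = 0 := by
  have hX := h.smoothX
  have hC := h.smoothC
  exact h.moment_closeUp_period (by fun_prop) t

theorem contDiff_bumpMatrix (h : IsFamily X C G) {β φ : ℝ → ℝ} (hβ : ContDiff ℝ ∞ β)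
    (hφ : ContDiff ℝ ∞ φ) (k i : Fin 3) :
    ContDiff ℝ ∞ fun p => bumpMatrix X C β φ p k i := by
  have h1 := contDiff_pi.mp (contDiff_moment h.smoothX (h.contDiff_bumpDirection hφ i)) k
  have h2 : ContDiff ℝ ∞ fun p : Fin 3 → ℝ => β (p 0) := by fun_prop
  exact h2.mul h1

theorem gramC_add_adjacent (h : IsFamily X C G) (t a b c : ℝ) :
    gramC X C t a b + gramC X C t b c = gramC X C t a c := by
  have hX := continuous_slice h.smoothX t
  have hC := continuous_slice h.smoothC t
  ext i j
  have hc : Continuous fun s => X (t, s) ^ (i : ℕ) * (C (t, s) ^ 2 * X (t, s) ^ (j : ℕ)) :=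
    (hX.pow _).mul ((hC.pow 2).mul (hX.pow _))
  exact intervalIntegral.integral_add_adjacent_intervals (hc.intervalIntegrable _ _)
    (hc.intervalIntegrable _ _)

theorem gramC_period (h : IsFamily X C G) (t a : ℝ) :
    gramC X C t a (a + 1) = gramC X C t 0 1 := by
  ext i j
  have hp : Function.Periodic
      (fun s => X (t, s) ^ (i : ℕ) * (C (t, s) ^ 2 * X (t, s) ^ (j : ℕ))) 1 := fun s => by
    simp only [h.periodicX, h.periodicC]
  simpa [gramC, gram] using hp.intervalIntegral_add_eq a 0

/-- Let g₁, g₂ be the Gram matrices of the arc and of the complementary arc, g = g₁ + g₂ that of the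
period, and gφ that of the arc with the bump as additional weight. The bump contributes gφ to the
moments over the arc and its closing correction -g₁ g⁻¹ gφ, in total g₂ g⁻¹ gφ. All three factors
are invertible as soon as C is not identically zero on either arc. -/
theorem det_bumpMatrix_ne_zero (h : IsFamily X C G) {β : ℝ → ℝ} {p : Fin 3 → ℝ}
    (hβ : β (p 0) ≠ 0) (hlt : p 1 < p 2) (hle : p 2 ≤ p 1 + 1 / 2)
    (h1 : ∃ s ∈ Ioo (p 1) (p 2), C (p 0, s) ≠ 0)
    (h2 : ∃ s ∈ Ioo (p 2) (p 1 + 1), C (p 0, s) ≠ 0) :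
    (bumpMatrix X C β (arcBump (p 1) (p 2)) p).det ≠ 0 := by
  set t := p 0
  set a := p 1
  set b := p 2
  set φ := arcBump a b
  have hX := continuous_slice h.smoothX t
  have hC := continuous_slice h.smoothC t
  have hφ : ContDiff ℝ ∞ φ := contDiff_arcBump a b
  let g₁ := gramC X C t a b
  let g₂ := gramC X C t b (a + 1)
  let g := gramC X C t 0 1
  let gφ := gram (fun s => φ s * C (t, s) ^ 2) (fun s => X (t, s)) a b
  have hg : g₁ + g₂ = g := by
    simp only [g₁, g₂, g, h.gramC_add_adjacent, h.gramC_period]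
  have hgu : IsUnit g.det := isUnit_iff_ne_zero.mpr (h.det_gramC_period_ne_zero t)
  have hfull : ∀ k i : Fin 3,
      moment X (fun p => φ p.2 * C p ^ 2 * X p ^ (i : ℕ)) t 0 1 k = gφ k i := by
    intro k i
    have hcont : Continuous fun s =>
        X (t, s) ^ (k : ℕ) * (φ s * C (t, s) ^ 2 * X (t, s) ^ (i : ℕ)) :=
      (hX.pow _).mul ((hφ.continuous.mul (hC.pow 2)).mul (hX.pow _))
    rw [← moment_period (h.periodicX t) _ a]
    · simp only [moment, gφ, gram, Matrix.of_apply]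
      rw [← intervalIntegral.integral_add_adjacent_intervals
        (hcont.intervalIntegrable a b) (hcont.intervalIntegrable b (a + 1))]
      rw [add_eq_left]
      refine (intervalIntegral.integral_congr (g := fun _ => (0 : ℝ)) fun s hs => ?_).trans
        (by simp)
      rw [uIcc_of_le (by linarith)] at hs
      simp only [φ, arcBump_eq_zero hs hlt.le, zero_mul, mul_zero]
    · intro s
      simp only [φ, arcBump_add_one, h.periodicC, h.periodicX]
  have hA : bumpMatrix X C β φ p = β t • (g₂ * (g⁻¹ * gφ)) := by
    have e1 : g₂ * (g⁻¹ * gφ) = gφ - g₁ * (g⁻¹ * gφ) := by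
      rw [eq_sub_iff_add_eq'.mpr hg, Matrix.sub_mul, ← Matrix.mul_assoc g,
        Matrix.mul_nonsing_inv _ hgu, Matrix.one_mul]
    rw [e1]
    ext k i
    have hr : ContDiff ℝ ∞ fun p : ℝ × ℝ => φ p.2 * C p ^ 2 * X p ^ (i : ℕ) := by
      have := h.smoothX
      have := h.smoothC
      fun_prop
    simp only [bumpMatrix, Matrix.of_apply, Matrix.smul_apply, smul_eq_mul, Matrix.sub_apply,
      bumpDirection]
    change β t * moment X _ t a b k = _
    rw [h.moment_closeUp hr, closingCoeff, Matrix.mulVec_neg, Matrix.mulVec_mulVec,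
      show moment X (fun p => φ p.2 * C p ^ 2 * X p ^ (i : ℕ)) t 0 1 = fun k => gφ k i from
        funext fun k => hfull k i]
    congr 1
    rw [Pi.add_apply, Pi.neg_apply, ← sub_eq_add_neg, ← Matrix.mul_assoc]
    rfl
  rw [hA, Matrix.det_smul, Matrix.det_mul, Matrix.det_mul]
  obtain ⟨s₁, hs₁, hc₁⟩ := h1
  obtain ⟨s₂, hs₂, hc₂⟩ := h2
  refine mul_ne_zero (pow_ne_zero _ hβ) (mul_ne_zero (h.det_gramC_ne_zero hs₂ hc₂)
    (mul_ne_zero (Matrix.isUnit_nonsing_inv_det _ hgu).ne_zero ?_))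
  have hpos := arcBump_pos hs₁ hle
  exact det_gram_ne_zero (ρ := fun s => φ s * C (t, s) ^ 2) (hφ.continuous.mul (hC.pow 2)) hC
    (h.deriv t) (fun s => mul_nonneg (arcBump_nonneg a b s) (sq_nonneg _)) hs₁ (by positivity) hc₁

end IsFamily

/-! ### Removing double points -/

/-- Rolle's theorem for the primitive of `f`. -/
theorem integral_ne_zero_of_forall_ne_zero {f : ℝ → ℝ} {a b : ℝ} (hf : Continuous f) (hab : a < b)
    (h : ∀ s ∈ Ioo a b, f s ≠ 0) : ∫ s in a..b, f s ≠ 0 := by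
  intro h0
  have hd : ∀ s, HasDerivAt (fun s => ∫ σ in a..s, f σ) (f s) s := fun s =>
    integral_hasDerivAt_right (hf.intervalIntegrable _ _)
      (hf.stronglyMeasurableAtFilter _ _) hf.continuousAt
  obtain ⟨c, hc, hc0⟩ := exists_hasDerivAt_eq_zero hab
    (fun s _ => (hd s).continuousAt.continuousWithinAt) (by simp [h0]) (fun s _ => hd s)
  exact h c hc hc0

/-- No perturbation of `G` by less than `ε |C|` has a double point at `p`. -/
def IsStable (X C G : ℝ × ℝ → ℝ) (ε : ℝ) (p : Fin 3 → ℝ) : Prop :=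
  ∀ r : ℝ × ℝ → ℝ, (Continuous fun s => r (p 0, s)) →
    (∀ s, |r (p 0, s)| ≤ ε * |C (p 0, s)|) →
    ¬ IsDouble X (fun q => G q + r q) (p 0) (p 1) (p 2)

theorem IsStable.mono {X C G : ℝ × ℝ → ℝ} {ε ε' : ℝ} {p : Fin 3 → ℝ}
    (h : IsStable X C G ε p) (hε : ε' ≤ ε) : IsStable X C G ε' p :=
  fun r hr hle => h r hr fun s => (hle s).trans (mul_le_mul_of_nonneg_right hε (abs_nonneg _))

/-- Near the diagonal the whole interval from `p 1` to `p 2` is close to `p₀ 1`, so an open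
condition holds along it. -/
theorem eventually_forall_Icc {P : ℝ × ℝ → Prop} {p₀ : Fin 3 → ℝ} (hp : p₀ 1 = p₀ 2)
    (hP : ∀ᶠ q in 𝓝 (p₀ 0, p₀ 1), P q) : ∀ᶠ p in 𝓝 p₀, ∀ s ∈ Icc (p 1) (p 2), P (p 0, s) := by
  obtain ⟨δ, hδ, hball⟩ := Metric.eventually_nhds_iff.mp hP
  have h0 : ∀ i, ∀ᶠ p : Fin 3 → ℝ in 𝓝 p₀, |p i - p₀ i| < δ := fun i => by
    have := (continuous_apply (A := fun _ : Fin 3 => ℝ) i).continuousAt (x := p₀)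
    exact Metric.tendsto_nhds.mp this δ hδ
  filter_upwards [h0 0, h0 1, h0 2] with p h0 h1 h2 s hs
  refine hball (max_lt h0 ?_)
  rw [← hp] at h2
  rw [abs_lt] at h1 h2
  rw [Real.dist_eq, abs_lt]
  exact ⟨by linarith [hs.1], by linarith [hs.2]⟩

namespace IsFamily

variable {X C G : ℝ × ℝ → ℝ}

/-- Either the values of X at the two ends differ, which is an open condition not involving G, or
some moment is nonzero and dominates the corresponding moment of a small perturbation. -/
theorem exists_isStable_of_not_isDouble (h : IsFamily X C G) {p₀ : Fin 3 → ℝ}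
    (hp : ¬ IsDouble X G (p₀ 0) (p₀ 1) (p₀ 2)) :
    ∃ ε > 0, ∀ᶠ p in 𝓝 p₀, IsStable X C G ε p := by
  have hX := h.smoothX
  have hC := h.smoothC
  have hXc := h.smoothX.continuous
  by_cases hne : X (p₀ 0, p₀ 1) = X (p₀ 0, p₀ 2)
  · obtain ⟨k, hk⟩ : ∃ k, moment X G (p₀ 0) (p₀ 1) (p₀ 2) k ≠ 0 := by
      by_contra! hcon
      exact hp ⟨hne, funext hcon⟩
    -- The moment of the perturbation is at most ε ∫ |Xᵏ C|. Replacing |y| by the larger y² + 1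
    -- makes the bound smooth in the parameters.
    let B : (Fin 3 → ℝ) → ℝ := fun p =>
      ∫ s in p 1..p 2, ((X (p 0, s) ^ (k : ℕ) * C (p 0, s)) ^ 2 + 1)
    have hB : Continuous B := by
      refine ContDiff.continuous (𝕜 := ℝ) (n := ∞) ?_
      refine contDiff_intervalIntegral (f := fun q : (Fin 3 → ℝ) × ℝ =>
        (X (q.1 0, q.2) ^ (k : ℕ) * C (q.1 0, q.2)) ^ 2 + 1) ?_ ?_ ?_ <;> fun_prop
    have hM : Continuous fun p : Fin 3 → ℝ => moment X G (p 0) (p 1) (p 2) k :=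
      (contDiff_pi.mp (contDiff_moment h.smoothX h.smoothG) k).continuous
    let ε := |moment X G (p₀ 0) (p₀ 1) (p₀ 2) k| / (2 * (|B p₀| + 1))
    have hk' := abs_pos.mpr hk
    have hε : 0 < ε := by positivity
    refine ⟨ε, hε, ?_⟩
    have hlt : ε * |B p₀| < |moment X G (p₀ 0) (p₀ 1) (p₀ 2) k| := by
      simp only [ε]
      rw [div_mul_eq_mul_div, div_lt_iff₀ (by positivity)]
      nlinarith [abs_nonneg (B p₀)]
    filter_upwards [(continuous_const.mul hB.abs).continuousAt.eventually_lt
      hM.abs.continuousAt hlt] with p hp r hr hrle hd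
    have hXs := continuous_slice h.smoothX (p 0)
    have hCs := continuous_slice h.smoothC (p 0)
    have hGs := continuous_slice h.smoothG (p 0)
    have h1 := congrFun hd.2 k
    rw [moment_add hXs hGs hr, Pi.add_apply, Pi.zero_apply] at h1
    have h2 : ‖moment X r (p 0) (p 1) (p 2) k‖ ≤ |∫ s in p 1..p 2,
        ε * ((X (p 0, s) ^ (k : ℕ) * C (p 0, s)) ^ 2 + 1)| := by
      refine norm_integral_le_abs_of_norm_le (Eventually.of_forall fun s => ?_) ?_
      · rw [Real.norm_eq_abs, abs_mul]
        have h3 := hrle s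
        have h4 : |X (p 0, s) ^ (k : ℕ)| * |C (p 0, s)| ≤
            (X (p 0, s) ^ (k : ℕ) * C (p 0, s)) ^ 2 + 1 := by
          rw [← abs_mul, ← sq_abs]
          nlinarith [sq_nonneg (|X (p 0, s) ^ (k : ℕ) * C (p 0, s)| - 1 / 2)]
        calc |X (p 0, s) ^ (k : ℕ)| * |r (p 0, s)|
            ≤ |X (p 0, s) ^ (k : ℕ)| * (ε * |C (p 0, s)|) := by gcongr
          _ = ε * (|X (p 0, s) ^ (k : ℕ)| * |C (p 0, s)|) := by ring
          _ ≤ _ := by gcongr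
      · have hcont : Continuous fun s => ε * ((X (p 0, s) ^ (k : ℕ) * C (p 0, s)) ^ 2 + 1) :=
          continuous_const.mul ((((hXs.pow _).mul hCs).pow 2).add continuous_const)
        exact hcont.intervalIntegrable _ _
    rw [intervalIntegral.integral_const_mul, abs_mul, abs_of_pos hε, Real.norm_eq_abs] at h2
    have h5 : moment X G (p 0) (p 1) (p 2) k = -moment X r (p 0) (p 1) (p 2) k := by linarith
    rw [h5, abs_neg] at hp
    exact absurd hp (not_lt.mpr h2)
  · refine ⟨1, one_pos, ?_⟩
    have h1 : Continuous fun p : Fin 3 → ℝ => X (p 0, p 1) := by fun_prop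
    have h2 : Continuous fun p : Fin 3 → ℝ => X (p 0, p 2) := by fun_prop
    filter_upwards [(h1.sub h2).continuousAt.eventually_ne (sub_ne_zero.mpr hne)]
      with p hp r _ _ hd
    exact hp (sub_eq_zero.mpr hd.1)

/-- Where C ≠ 0, the function X is locally injective in s. Where C = 0, the inequality |C| < |G|
persists nearby, so G + r has no zeros when |r| ≤ |C|, and its integral, the zeroth moment, is
nonzero. -/
theorem eventually_isStable_diagonal (h : IsFamily X C G) {p₀ : Fin 3 → ℝ} (hp : p₀ 1 = p₀ 2) :
    ∀ᶠ p in 𝓝 p₀, p 1 < p 2 → IsStable X C G 1 p := by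
  have hCc := h.smoothC.continuous
  have hGc := h.smoothG.continuous
  by_cases h0 : C (p₀ 0, p₀ 1) = 0
  · have h1 : |C (p₀ 0, p₀ 1)| < |G (p₀ 0, p₀ 1)| := by
      rw [h0, abs_zero]
      exact abs_pos.mpr ((h.regular _ _).resolve_left (not_not.mpr h0))
    filter_upwards [eventually_forall_Icc hp
      (hCc.abs.continuousAt.eventually_lt hGc.abs.continuousAt h1)] with p hev hlt r hr hrle hd
    have hGs := continuous_slice h.smoothG (p 0)
    refine integral_ne_zero_of_forall_ne_zero (hGs.add hr) hlt (fun s hs h2 => ?_)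
      (by simpa [moment] using congrFun hd.2 0)
    have h3 : |G (p 0, s)| = |r (p 0, s)| := by
      rw [← abs_neg (r (p 0, s)), ← eq_neg_of_add_eq_zero_left h2]
    have h4 := hev s ⟨hs.1.le, hs.2.le⟩
    have h5 := hrle s
    linarith
  · filter_upwards [eventually_forall_Icc hp (hCc.continuousAt.eventually_ne h0)]
      with p hev hlt r _ _ hd
    obtain ⟨s, hs, hs0⟩ := exists_hasDerivAt_eq_zero hlt
      (continuous_slice h.smoothX (p 0)).continuousOn hd.1 (fun s _ => h.deriv (p 0) s)
    exact hev s ⟨hs.1.le, hs.2.le⟩ hs0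

theorem moment_ne_zero_of_forall_eq_zero (h : IsFamily X C G) {t a b : ℝ} (hab : a < b)
    (hc : ∀ s ∈ Ioo a b, C (t, s) = 0) : moment X G t a b ≠ 0 := by
  intro h0
  refine integral_ne_zero_of_forall_ne_zero (continuous_slice h.smoothG t) hab (fun s hs => ?_)
    (by simpa [moment] using congrFun h0 0)
  exact (h.regular t s).resolve_left (not_not.mpr (hc s hs))

/-- Near each `p₀` either a fixed set of perturbations acts invertibly on the moments, or there are
no double points at all, even after a small perturbation. -/
theorem exists_bumps_nhds (h : IsFamily X C G) {β : ℝ → ℝ} (hβ : ContDiff ℝ ∞ β)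
    (hclosed : ∀ t, moment X G t 0 1 = 0) {p₀ : Fin 3 → ℝ}
    (hle : p₀ 1 ≤ p₀ 2) (hle' : p₀ 2 ≤ p₀ 1 + 1 / 2) (hsimple : β (p₀ 0) = 0 → IsSimple X G (p₀ 0)) :
    ∃ ε > 0, ∃ φ : ℝ → ℝ, ContDiff ℝ ∞ φ ∧ (∀ s, φ (s + 1) = φ s) ∧
      ∀ᶠ p in 𝓝 p₀, p 1 < p 2 → (bumpMatrix X C β φ p).det ≠ 0 ∨ IsStable X C G ε p := by
  have hbump := contDiff_arcBump (p₀ 1) (p₀ 2)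
  have hper := arcBump_add_one (p₀ 1) (p₀ 2)
  rcases hle.eq_or_lt with heq | hlt
  · refine ⟨1, one_pos, _, hbump, hper, ?_⟩
    filter_upwards [h.eventually_isStable_diagonal heq] with p hp hlt
    exact Or.inr (hp hlt)
  by_cases hd : IsDouble X G (p₀ 0) (p₀ 1) (p₀ 2)
  · refine ⟨1, one_pos, _, hbump, hper, ?_⟩
    -- At a double point C vanishes identically on neither arc: otherwise G would have no zeros
    -- there and a nonzero integral, while the moments vanish over the arc and, the loop being
    -- closed, over its complement. Moreover β ≠ 0, since there are no double points where β = 0.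
    have hdet : (bumpMatrix X C β (arcBump (p₀ 1) (p₀ 2)) p₀).det ≠ 0 := by
      refine h.det_bumpMatrix_ne_zero (fun h0 => hsimple h0 _ _ hlt hle' hd) hlt hle' ?_ ?_
      · by_contra! hcon
        exact h.moment_ne_zero_of_forall_eq_zero hlt hcon hd.2
      · by_contra! hcon
        refine h.moment_ne_zero_of_forall_eq_zero (by linarith) hcon ?_
        have h1 := moment_add_adjacent (continuous_slice h.smoothX (p₀ 0))
          (continuous_slice h.smoothG (p₀ 0)) (p₀ 1) (p₀ 2) (p₀ 1 + 1)
        rwa [hd.2, zero_add, moment_period (h.periodicX _) (h.periodicG _), hclosed] at h1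
    filter_upwards [(contDiff_det (h.contDiff_bumpMatrix hβ hbump)).continuous.continuousAt.eventually_ne
      hdet] with p hp _
    exact Or.inl hp
  · obtain ⟨ε, hε, hev⟩ := h.exists_isStable_of_not_isDouble hd
    refine ⟨ε, hε, _, hbump, hper, ?_⟩
    filter_upwards [hev] with p hp _
    exact Or.inr hp

theorem exists_bumps (h : IsFamily X C G) {β : ℝ → ℝ} (hβ : ContDiff ℝ ∞ β)
    (hclosed : ∀ t, moment X G t 0 1 = 0) {I : Set ℝ} (hI : IsCompact I)
    (hsimple : ∀ t ∈ I, β t = 0 → IsSimple X G t) :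
    ∃ ε > 0, ∃ Φ : Finset (ℝ → ℝ), (∀ φ ∈ Φ, ContDiff ℝ ∞ φ ∧ ∀ s, φ (s + 1) = φ s) ∧
      ∀ p : Fin 3 → ℝ, p 0 ∈ I → p 1 ∈ Icc (0 : ℝ) 1 → p 1 < p 2 → p 2 ≤ p 1 + 1 / 2 →
        (∃ φ ∈ Φ, (bumpMatrix X C β φ p).det ≠ 0) ∨ IsStable X C G ε p := by
  classical
  -- The diagonal `p 1 = p 2` is included for compactness. Bounding the length by 1/2 keeps `K` away
  -- from `p 2 = p 1 + 1`, where the end points coincide trivially.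
  let K : Set (Fin 3 → ℝ) := {p | p 0 ∈ I ∧ p 1 ∈ Icc (0 : ℝ) 1 ∧ p 1 ≤ p 2 ∧ p 2 ≤ p 1 + 1 / 2}
  have hK : IsCompact K := by
    have hpi : IsCompact (Set.univ.pi ![I, Icc (0 : ℝ) 1, Icc (0 : ℝ) 2]) := by
      refine isCompact_univ_pi fun i => ?_
      fin_cases i
      · exact hI
      · exact isCompact_Icc
      · exact isCompact_Icc
    have hcl : IsClosed {p : Fin 3 → ℝ | p 1 ≤ p 2 ∧ p 2 ≤ p 1 + 1 / 2} := by
      rw [ofPred_and]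
      exact (isClosed_le (by fun_prop) (by fun_prop)).inter
        (isClosed_le (by fun_prop) (by fun_prop))
    refine (hpi.inter_right hcl).of_isClosed_subset ?_ ?_
    · refine (hI.isClosed.preimage (continuous_apply 0)).inter
        ((isClosed_Icc.preimage (continuous_apply 1)).inter hcl)
    · rintro p ⟨h0, h1, h2, h3⟩
      refine ⟨fun i _ => ?_, h2, h3⟩
      fin_cases i
      · exact h0
      · exact h1
      · exact ⟨h1.1.trans h2, by simpa using (by linarith [h1.2] : p 2 ≤ 2)⟩
  have hmain : ∃ ε > 0, ∃ Φ : Finset (ℝ → ℝ),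
      (∀ φ ∈ Φ, ContDiff ℝ ∞ φ ∧ ∀ s, φ (s + 1) = φ s) ∧
      ∀ p ∈ K, p 1 < p 2 →
        (∃ φ ∈ Φ, (bumpMatrix X C β φ p).det ≠ 0) ∨ IsStable X C G ε p := by
    refine hK.induction_on (p := fun S => ∃ ε > 0, ∃ Φ : Finset (ℝ → ℝ),
      (∀ φ ∈ Φ, ContDiff ℝ ∞ φ ∧ ∀ s, φ (s + 1) = φ s) ∧
      ∀ p ∈ S, p 1 < p 2 →
        (∃ φ ∈ Φ, (bumpMatrix X C β φ p).det ≠ 0) ∨ IsStable X C G ε p) ?_ ?_ ?_ ?_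
    · exact ⟨1, one_pos, ∅, by simp, by simp⟩
    · rintro S T hST ⟨ε, hε, Φ, hΦ, hT⟩
      exact ⟨ε, hε, Φ, hΦ, fun p hp => hT p (hST hp)⟩
    · rintro S T ⟨ε, hε, Φ, hΦ, hS⟩ ⟨ε', hε', Φ', hΦ', hT⟩
      refine ⟨min ε ε', lt_min hε hε', Φ ∪ Φ', fun φ hφ => ?_, ?_⟩
      · rcases Finset.mem_union.mp hφ with hφ | hφ
        exacts [hΦ φ hφ, hΦ' φ hφ]
      · rintro p (hp | hp) hlt
        · rcases hS p hp hlt with ⟨φ, hφ, hdet⟩ | hst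
          · exact Or.inl ⟨φ, Finset.mem_union_left _ hφ, hdet⟩
          · exact Or.inr (hst.mono (min_le_left _ _))
        · rcases hT p hp hlt with ⟨φ, hφ, hdet⟩ | hst
          · exact Or.inl ⟨φ, Finset.mem_union_right _ hφ, hdet⟩
          · exact Or.inr (hst.mono (min_le_right _ _))
    · rintro p₀ ⟨h0, -, h2, h3⟩
      obtain ⟨ε, hε, φ, hφ, hper, hev⟩ := h.exists_bumps_nhds hβ hclosed h2 h3 (hsimple _ h0)
      refine ⟨_, nhdsWithin_le_nhds hev, ε, hε, {φ}, by simpa using ⟨hφ, hper⟩, ?_⟩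
      intro p hp hlt
      simpa using hp hlt
  obtain ⟨ε, hε, Φ, hΦ, hp⟩ := hmain
  exact ⟨ε, hε, Φ, hΦ, fun p h0 h1 h2 h3 => hp p ⟨h0, h1, h2.le, h3⟩ h2⟩

/-- Parametric transversality: G is perturbed by a finite combination of bump directions. Almost
every coefficient vector avoids double points where some bump matrix is invertible, and every small
one avoids them where the family is stable. -/
theorem exists_simple (h : IsFamily X C G) {β : ℝ → ℝ} (hβ : ContDiff ℝ ∞ β)
    (hclosed : ∀ t, moment X G t 0 1 = 0) {I : Set ℝ} (hI : IsCompact I)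
    (hsimple : ∀ t ∈ I, β t = 0 → IsSimple X G t)
    (hnull : volume {p : Fin 3 → ℝ | β (p 0) ≠ 0 ∧ X (p 0, p 1) = X (p 0, p 2)} = 0) :
    ∃ G' : ℝ × ℝ → ℝ, IsFamily X C G' ∧ (∀ t, moment X G' t 0 1 = 0) ∧
      (∀ p, C p = 0 → G' p = G p) ∧ (∀ t s, β t = 0 → G' (t, s) = G (t, s)) ∧
      ∀ t ∈ I, IsSimple X G' t := by
  classical
  obtain ⟨ε, hε, Φ, hΦ, hcover⟩ := h.exists_bumps hβ hclosed hI hsimple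
  let R : (Φ → Fin 3 → ℝ) → ℝ × ℝ → ℝ := fun v p =>
    ∑ φ : Φ, ∑ i, β p.1 * bumpDirection X C φ i p * v φ i
  have hbd : ∀ (φ : Φ) i, ContDiff ℝ ∞ (bumpDirection X C φ i) := fun φ i =>
    h.contDiff_bumpDirection (hΦ φ φ.2).1 i
  have hRs : ∀ v, ContDiff ℝ ∞ (R v) := fun v =>
    ContDiff.sum fun φ _ => ContDiff.sum fun i _ =>
      ((hβ.comp contDiff_fst).mul (hbd φ i)).mul contDiff_const
  have hRper : ∀ v t s, R v (t, s + 1) = R v (t, s) := fun v t s => by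
    simp only [R, h.bumpDirection_periodic (hΦ _ (Subtype.prop _)).2]
  have hR0 : ∀ v p, C p = 0 → R v p = 0 := fun v p hp => by
    simp [R, bumpDirection, closeUp, hp]
  have hmom : ∀ v t a b, moment X (R v) t a b =
      ∑ φ : Φ, (bumpMatrix X C β φ ![t, a, b]).mulVec (v φ) := by
    intro v t a b
    funext k
    simp only [moment, R, Finset.mul_sum, Finset.sum_apply, Matrix.mulVec, dotProduct, bumpMatrix,
      Matrix.of_apply, Matrix.cons_val]
    have hintegral : ∀ (φ : Φ) i, Continuous fun s =>
        X (t, s) ^ (k : ℕ) * (β t * bumpDirection X C φ i (t, s) * v φ i) := fun φ i =>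
      ((continuous_slice h.smoothX t).pow _).mul ((continuous_const.mul
        (continuous_slice (hbd φ i) t)).mul continuous_const)
    rw [intervalIntegral.integral_finsetSum fun φ _ =>
      (continuous_finsetSum _ fun i _ => hintegral φ i).intervalIntegrable _ _]
    refine Finset.sum_congr rfl fun φ _ => ?_
    rw [intervalIntegral.integral_finsetSum fun i _ => (hintegral φ i).intervalIntegrable _ _]
    refine Finset.sum_congr rfl fun i _ => ?_
    rw [← intervalIntegral.integral_const_mul, ← intervalIntegral.integral_mul_const]
    exact intervalIntegral.integral_congr fun s _ => by ring
  -- Each direction is divisible by C², so the perturbation is small relative to |C| even near zeros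
  -- of C.
  have hsmall : ∀ᶠ v in 𝓝 (0 : Φ → Fin 3 → ℝ), ∀ t ∈ I, ∀ s, |R v (t, s)| ≤ ε * |C (t, s)| := by
    let κ : Φ → Fin 3 → ℝ × ℝ → ℝ := fun φ i p =>
      (φ : ℝ → ℝ) p.2 * X p ^ (i : ℕ) + ∑ j : Fin 3,
        closingCoeff X C (fun p => (φ : ℝ → ℝ) p.2 * C p ^ 2 * X p ^ (i : ℕ)) p.1 j * X p ^ (j : ℕ)
    have hκ : ∀ φ i, Continuous (κ φ i) := by
      intro φ i
      have hφ := (hΦ φ φ.2).1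
      have hX := h.smoothX
      have hC := h.smoothC
      have hc : ∀ j, ContDiff ℝ ∞ fun t => closingCoeff X C
          (fun p => (φ : ℝ → ℝ) p.2 * C p ^ 2 * X p ^ (i : ℕ)) t j := fun j =>
        h.contDiff_closingCoeff (by fun_prop) j
      refine ((hφ.continuous.comp continuous_snd).mul (hX.continuous.pow _)).add
        (continuous_finsetSum _ fun j _ => ?_)
      exact ((hc j).continuous.comp continuous_fst).mul (hX.continuous.pow _)
    have hRκ : ∀ v p, R v p = C p * (β p.1 * C p * ∑ φ : Φ, ∑ i, κ φ i p * v φ i) := by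
      intro v p
      simp only [R, Finset.mul_sum]
      refine Finset.sum_congr rfl fun φ _ => Finset.sum_congr rfl fun i _ => ?_
      simp only [bumpDirection, closeUp, κ]
      ring
    have hev : ∀ᶠ v in 𝓝 (0 : Φ → Fin 3 → ℝ), ∀ p ∈ I ×ˢ Icc (0 : ℝ) 1,
        |β p.1 * C p * ∑ φ : Φ, ∑ i, κ φ i p * v φ i| < ε := by
      refine (hI.prod isCompact_Icc).eventually_forall_of_forall_eventually fun p _ => ?_
      have hcont : Continuous fun z : (Φ → Fin 3 → ℝ) × (ℝ × ℝ) =>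
          |β z.2.1 * C z.2 * ∑ φ : Φ, ∑ i, κ φ i z.2 * z.1 φ i| := by
        have hβc := hβ.continuous
        have hCc := h.smoothC.continuous
        fun_prop
      exact hcont.continuousAt.eventually_lt continuousAt_const (by simpa using hε)
    filter_upwards [hev] with v hv t ht s
    have h1 : R v (t, s) = R v (t, Int.fract s) := by
      conv_lhs => rw [← Int.fract_add_floor s]
      exact apply_add_int (hRper v t) _ _
    have h2 : C (t, s) = C (t, Int.fract s) := by
      conv_lhs => rw [← Int.fract_add_floor s]
      exact apply_add_int (h.periodicC t) _ _
    rw [h1, h2, hRκ, abs_mul, mul_comm]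
    have h3 := hv (t, Int.fract s) ⟨ht, Int.fract_nonneg s, (Int.fract_lt_one s).le⟩
    exact mul_le_mul_of_nonneg_right h3.le (abs_nonneg _)
  have hae : ∀ᵐ v : Φ → Fin 3 → ℝ, ∀ φ : Φ, ¬ ∃ p : Fin 3 → ℝ,
      (β (p 0) ≠ 0 ∧ X (p 0, p 1) = X (p 0, p 2)) ∧ (bumpMatrix X C β φ p).det ≠ 0 ∧
      moment X G (p 0) (p 1) (p 2) + ∑ ψ : Φ, (bumpMatrix X C β ψ p).mulVec (v ψ) = 0 := by
    rw [ae_all_iff]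
    intro φ
    have := null_setOf_solvable (contDiff_moment h.smoothX h.smoothG)
      (A := fun ψ : Φ => bumpMatrix X C β ψ)
      (fun ψ => h.contDiff_bumpMatrix hβ (hΦ ψ ψ.2).1) hnull φ
    rw [ae_iff]
    simp only [not_not]
    exact this
  -- A set of full measure is dense, so it contains arbitrarily small `v`.
  obtain ⟨v, hv, hvs⟩ := (Measure.dense_of_ae hae).inter_nhds_nonempty hsmall
  have hper : ∀ t s, G (t, s + 1) + R v (t, s + 1) = G (t, s) + R v (t, s) := fun t s => by
    rw [h.periodicG, hRper]
  have hmom' : ∀ t a b, moment X (fun p => G p + R v p) t a b = moment X G t a b +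
      ∑ φ : Φ, (bumpMatrix X C β φ ![t, a, b]).mulVec (v φ) := fun t a b => by
    rw [moment_add (continuous_slice h.smoothX t) (continuous_slice h.smoothG t)
      (continuous_slice (hRs v) t), hmom]
  refine ⟨fun p => G p + R v p, h.of_eq_of_eq_zero (h.smoothG.add (hRs v)) hper ?_, ?_, ?_, ?_, ?_⟩
  · intro p hp
    rw [hR0 v p hp, add_zero]
  · intro t
    rw [hmom', hclosed, zero_add]
    refine Finset.sum_eq_zero fun φ _ => ?_
    have : bumpMatrix X C β φ ![t, 0, 1] = 0 := by
      ext k i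
      simp [bumpMatrix, h.moment_bumpDirection_period (hΦ φ φ.2).1]
    rw [this, Matrix.zero_mulVec]
  · intro p hp
    simp only [hR0 v p hp, add_zero]
  · intro t s ht
    simp [R, ht]
  · intro t ht a b hab hab' hd
    obtain ⟨a, n, ha, rfl⟩ : ∃ a' : ℝ, ∃ n : ℤ, a' ∈ Icc (0 : ℝ) 1 ∧ a = a' + n :=
      ⟨Int.fract a, ⌊a⌋, ⟨Int.fract_nonneg a, (Int.fract_lt_one a).le⟩,
        (Int.fract_add_floor a).symm⟩
    obtain ⟨b, rfl⟩ : ∃ b' : ℝ, b = b' + n := ⟨b - n, by ring⟩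
    have hd' : IsDouble X (fun p => G p + R v p) t a b := by
      obtain ⟨h1, h2⟩ := hd
      rw [apply_add_int (h.periodicX t), apply_add_int (h.periodicX t)] at h1
      rw [moment_add_int (h.periodicX t) (hper t)] at h2
      exact ⟨h1, h2⟩
    rcases hcover ![t, a, b] ht ha (by simpa using hab) (by simp; linarith) with ⟨φ, hφ, hdet⟩ | hst
    · refine hv ⟨φ, hφ⟩ ⟨![t, a, b], ⟨?_, hd'.1⟩, hdet, ?_⟩
      -- The bump matrix carries the factor β, so where it is invertible β is nonzero and the point
      -- belongs to the null set.
      · intro h0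
        apply hdet
        have : bumpMatrix X C β φ ![t, a, b] = 0 := by
          ext k i
          simp only [bumpMatrix, Matrix.of_apply, h0, zero_mul, Matrix.zero_apply]
        rw [this, Matrix.det_zero]
      · exact (hmom' t a b).symm.trans hd'.2
    · exact hst (R v) (continuous_slice (hRs v) t) (hvs t ht) hd'

end IsFamily

/-! ### Making the level sets of `X` null -/

theorem null_setOf_graph {f : ℝ → ℝ} (hf : Differentiable ℝ f) :
    volume {p : Fin 3 → ℝ | p 2 = f (p 1)} = 0 := by
  let D : Set (Fin 3 → ℝ) := Function.eval 2 ⁻¹' {(0 : ℝ)}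
  have hD : volume D = 0 :=
    (Measure.quasiMeasurePreserving_eval (fun _ : Fin 3 => (volume : Measure ℝ)) 2).preimage_null
      (measure_singleton 0)
  let g : (Fin 3 → ℝ) → (Fin 3 → ℝ) := fun q => ![q 0, q 1, f (q 1)]
  have hg : Differentiable ℝ g := by
    rw [differentiable_pi]
    intro i
    fin_cases i
    · exact differentiable_apply (𝕜 := ℝ) (0 : Fin 3)
    · exact differentiable_apply (𝕜 := ℝ) (1 : Fin 3)
    · exact hf.comp (differentiable_apply (𝕜 := ℝ) (1 : Fin 3))
  refine measure_mono_null ?_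
    (addHaar_image_eq_zero_of_differentiableOn_of_addHaar_eq_zero volume hg.differentiableOn hD)
  intro p hp
  refine ⟨![p 0, p 1, 0], by simp [D], ?_⟩
  ext i
  fin_cases i
  · rfl
  · rfl
  · exact (show p 2 = f (p 1) from hp).symm

theorem null_setOf_sin_eq_sin :
    volume {p : Fin 3 → ℝ | Real.sin (2 * Real.pi * p 1) = Real.sin (2 * Real.pi * p 2)} = 0 := by
  refine measure_mono_null (t := ⋃ k : ℤ, ({p : Fin 3 → ℝ | p 2 = k + p 1} ∪
    {p : Fin 3 → ℝ | p 2 = k + 1 / 2 - p 1})) ?_ ?_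
  · intro p hp
    obtain ⟨k, hk⟩ := Real.sin_eq_sin_iff.mp hp
    have hpi := Real.pi_pos
    refine mem_iUnion.mpr ⟨k, ?_⟩
    rcases hk with hk | hk
    · refine Or.inl (mul_left_cancel₀ (by positivity : 2 * Real.pi ≠ 0) ?_)
      linear_combination hk
    · refine Or.inr (mul_left_cancel₀ (by positivity : 2 * Real.pi ≠ 0) ?_)
      linear_combination hk
  · refine measure_iUnion_null fun k => measure_union_null ?_ ?_
    · exact null_setOf_graph (f := fun s => k + s) (by fun_prop)
    · exact null_setOf_graph (f := fun s => k + 1 / 2 - s) (by fun_prop)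

/-- The perturbation of `X` in the direction of a sine. -/
noncomputable def sineShift (X : ℝ × ℝ → ℝ) (β : ℝ → ℝ) (u : ℝ) : ℝ × ℝ → ℝ :=
  fun p => X p + u * β p.1 * Real.sin (2 * Real.pi * p.2)

/-- The derivative of `sineShift`. -/
noncomputable def sineShiftDeriv (C : ℝ × ℝ → ℝ) (β : ℝ → ℝ) (u : ℝ) : ℝ × ℝ → ℝ :=
  fun p => C p + u * β p.1 * (2 * Real.pi * Real.cos (2 * Real.pi * p.2))

/-- Fubini: for almost every `p` the two sines differ; if also β ≠ 0, the condition is affine in `u`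
with nonzero slope and holds for at most one `u`. So the set of pairs `(u, p)` is null, and almost
all of its slices at fixed `u` are null. -/
theorem ae_null_setOf_sineShift_eq {X : ℝ × ℝ → ℝ} {β : ℝ → ℝ} (hX : Continuous X)
    (hβ : Continuous β) : ∀ᵐ u : ℝ, volume {p : Fin 3 → ℝ |
      β (p 0) ≠ 0 ∧ sineShift X β u (p 0, p 1) = sineShift X β u (p 0, p 2)} = 0 := by
  let W : Set (ℝ × (Fin 3 → ℝ)) := {z | β (z.2 0) ≠ 0 ∧
    sineShift X β z.1 (z.2 0, z.2 1) = sineShift X β z.1 (z.2 0, z.2 2)}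
  have hW : MeasurableSet W := by
    refine MeasurableSet.inter (s₁ := {z : ℝ × (Fin 3 → ℝ) | β (z.2 0) ≠ 0})
      (s₂ := {z : ℝ × (Fin 3 → ℝ) |
        sineShift X β z.1 (z.2 0, z.2 1) = sineShift X β z.1 (z.2 0, z.2 2)}) ?_ ?_
    · exact (isOpen_ne_fun (by fun_prop) continuous_const).measurableSet
    · refine (isClosed_eq ?_ ?_).measurableSet <;> unfold sineShift <;> fun_prop
  have hnull : (volume.prod volume) W = 0 := by
    rw [← Measure.prod_swap, Measure.map_apply measurable_swap hW,
      Measure.measure_prod_null (measurable_swap hW)]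
    have hae : ∀ᵐ p : Fin 3 → ℝ, ¬ Real.sin (2 * Real.pi * p 1) = Real.sin (2 * Real.pi * p 2) := by
      rw [ae_iff]
      simpa only [not_not] using null_setOf_sin_eq_sin
    filter_upwards [hae] with p hp
    refine Set.Subsingleton.measure_zero ?_ _
    rintro u ⟨hu0, hu⟩ v ⟨-, hv⟩
    simp only [sineShift, Prod.fst_swap, Prod.snd_swap] at hu0 hu hv
    have h1 : (u - v) * (β (p 0) * (Real.sin (2 * Real.pi * p 1) -
        Real.sin (2 * Real.pi * p 2))) = 0 := by linear_combination hu - hv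
    have h2 := mul_ne_zero hu0 (sub_ne_zero.mpr hp)
    exact sub_eq_zero.mp ((mul_eq_zero.mp h1).resolve_right h2)
  exact Measure.measure_ae_null_of_prod_null hnull

/-- For small `u` the velocity stays nonzero and X stays nonconstant. The size of `u` can be chosen
uniformly because `hclamp` and periodicity reduce these conditions to compact sets. -/
theorem IsFamily.exists_sineShift {X C G : ℝ × ℝ → ℝ} (h : IsFamily X C G) {β : ℝ → ℝ}
    (hβ : ContDiff ℝ ∞ β) (hclamp : ∀ t, ∃ t' ∈ Icc (0 : ℝ) 1, β t = β t' ∧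
      ∀ s, C (t, s) = C (t', s) ∧ G (t, s) = G (t', s)) :
    ∃ u, IsFamily (sineShift X β u) (sineShiftDeriv C β u) G ∧ volume {p : Fin 3 → ℝ |
      β (p 0) ≠ 0 ∧ sineShift X β u (p 0, p 1) = sineShift X β u (p 0, p 2)} = 0 := by
  have hX := h.smoothX
  have hC := h.smoothC
  have hCc := h.smoothC.continuous
  have hGc := h.smoothG.continuous
  have hβc := hβ.continuous
  have hper : ∀ u t s, sineShiftDeriv C β u (t, s + 1) = sineShiftDeriv C β u (t, s) := by
    intro u t s
    simp only [sineShiftDeriv, h.periodicC, mul_add, mul_one, Real.cos_add_two_pi]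
  have hD : Continuous fun z : ℝ × (ℝ × ℝ) => sineShiftDeriv C β z.1 z.2 := by
    unfold sineShiftDeriv
    fun_prop
  have hreg : ∀ᶠ u in 𝓝 (0 : ℝ), ∀ p ∈ Icc (0 : ℝ) 1 ×ˢ Icc (0 : ℝ) 1,
      sineShiftDeriv C β u p ^ 2 + G p ^ 2 ≠ 0 := by
    refine (isCompact_Icc.prod isCompact_Icc).eventually_forall_of_forall_eventually
      fun p _ => ?_
    have hcont : Continuous fun z : ℝ × (ℝ × ℝ) =>
        sineShiftDeriv C β z.1 z.2 ^ 2 + G z.2 ^ 2 := by fun_prop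
    refine hcont.continuousAt.eventually_ne ?_
    simp only [sineShiftDeriv, zero_mul, add_zero]
    rcases h.regular p.1 p.2 with h0 | h0 <;> positivity
  have hnc : ∀ᶠ u in 𝓝 (0 : ℝ), ∀ t ∈ Icc (0 : ℝ) 1, ∃ s, sineShiftDeriv C β u (t, s) ≠ 0 := by
    refine isCompact_Icc.eventually_forall_of_forall_eventually fun t _ => ?_
    obtain ⟨s, hs⟩ := h.nonconst t
    have hcont : Continuous fun z : ℝ × ℝ => sineShiftDeriv C β z.1 (z.2, s) :=
      hD.comp (by fun_prop : Continuous fun z : ℝ × ℝ => (z.1, (z.2, s)))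
    filter_upwards [hcont.continuousAt.eventually_ne (x := ((0 : ℝ), t)) (y := 0)
      (by simpa [sineShiftDeriv] using hs)] with z hz
    exact ⟨s, hz⟩
  obtain ⟨u, hu, hu1, hu2⟩ := (Measure.dense_of_ae
    (ae_null_setOf_sineShift_eq h.smoothX.continuous hβc)).inter_nhds_nonempty (hreg.and hnc)
  have hclamp' : ∀ t, ∃ t' ∈ Icc (0 : ℝ) 1, ∀ s,
      sineShiftDeriv C β u (t, s) = sineShiftDeriv C β u (t', s) ∧ G (t, s) = G (t', s) := by
    intro t
    obtain ⟨t', ht', h1, h2⟩ := hclamp t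
    exact ⟨t', ht', fun s => ⟨by simp only [sineShiftDeriv, h1, (h2 s).1], (h2 s).2⟩⟩
  refine ⟨u, ⟨?_, ?_, h.smoothG, ?_, hper u, h.periodicG, ?_, ?_, ?_⟩, hu⟩
  · unfold sineShift
    fun_prop
  · unfold sineShiftDeriv
    fun_prop
  · intro t s
    simp only [sineShift, h.periodicX, mul_add, mul_one, Real.sin_add_two_pi]
  · intro t s
    have h1 : HasDerivAt (fun s => Real.sin (2 * Real.pi * s))
        (2 * Real.pi * Real.cos (2 * Real.pi * s)) s := by
      simpa [mul_comm] using ((hasDerivAt_id s).const_mul (2 * Real.pi)).sin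
    exact (h.deriv t s).add (h1.const_mul (u * β t))
  · intro t s
    obtain ⟨t', ht', h2⟩ := hclamp' t
    rw [(h2 s).1, (h2 s).2]
    have e1 : sineShiftDeriv C β u (t', s) = sineShiftDeriv C β u (t', Int.fract s) := by
      conv_lhs => rw [← Int.fract_add_floor s]
      exact apply_add_int (hper u t') _ _
    have e2 : G (t', s) = G (t', Int.fract s) := by
      conv_lhs => rw [← Int.fract_add_floor s]
      exact apply_add_int (h.periodicG t') _ _
    rw [e1, e2]
    by_contra! hcon
    refine hu1 (t', Int.fract s) ⟨ht', Int.fract_nonneg s, (Int.fract_lt_one s).le⟩ ?_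
    rw [hcon.1, hcon.2]
    simp
  · intro t
    obtain ⟨t', ht', h2⟩ := hclamp' t
    obtain ⟨s, hs⟩ := hu2 t' ht'
    exact ⟨s, by rwa [(h2 s).1]⟩

/-- A family of plane curves can be perturbed so that it closes up and lifts to embedded
horizontal loops, without changing it where it already does and `β` vanishes. -/
theorem IsFamily.exists_embedded {X C G : ℝ × ℝ → ℝ} (h : IsFamily X C G) {β : ℝ → ℝ}
    (hβ : ContDiff ℝ ∞ β) (hclamp : ∀ t, ∃ t' ∈ Icc (0 : ℝ) 1, β t = β t' ∧
      ∀ s, C (t, s) = C (t', s) ∧ G (t, s) = G (t', s)) {I : Set ℝ} (hI : IsCompact I)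
    (hemb : ∀ t ∈ I, β t = 0 → moment X G t 0 1 = 0 ∧ IsSimple X G t) :
    ∃ (u : ℝ) (G' : ℝ × ℝ → ℝ), IsFamily (sineShift X β u) (sineShiftDeriv C β u) G ∧
      IsFamily (sineShift X β u) (sineShiftDeriv C β u) G' ∧
      (∀ p, sineShiftDeriv C β u p = 0 → G' p = G p) ∧
      (∀ t ∈ I, β t = 0 → ∀ s, G' (t, s) = G (t, s)) ∧
      ∀ t ∈ I, moment (sineShift X β u) G' t 0 1 = 0 ∧ IsSimple (sineShift X β u) G' t := by
  obtain ⟨u, hu, hnull⟩ := h.exists_sineShift hβ hclamp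
  set X' := sineShift X β u
  set C' := sineShiftDeriv C β u
  have hX' : ∀ t, β t = 0 → ∀ s, X' (t, s) = X (t, s) := fun t ht s => by
    simp [X', sineShift, ht]
  have hmom : ∀ t, β t = 0 → ∀ r a b, moment X' r t a b = moment X r t a b := fun t ht r a b => by
    funext k
    simp only [moment, hX' t ht]
  -- Where β = 0 the sine is absent and the moments already vanish, so the closing correction is
  -- zero.
  have hcl : ∀ t ∈ I, β t = 0 → ∀ s, closeUp X' C' G (t, s) = G (t, s) := fun t ht h0 s =>
    closeUp_of_moment_eq_zero ((hmom t h0 G 0 1).trans (hemb t ht h0).1) s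
  have hfam : IsFamily X' C' (closeUp X' C' G) :=
    hu.of_eq_of_eq_zero (hu.contDiff_closeUp hu.smoothG) (hu.closeUp_periodic hu.periodicG)
      fun p hp => closeUp_of_eq_zero hp
  have hs : ∀ t ∈ I, β t = 0 → IsSimple X' (closeUp X' C' G) t := by
    intro t ht h0 a b hab hab' hd
    refine (hemb t ht h0).2 a b hab hab' ⟨?_, ?_⟩
    · simpa only [hX' t h0] using hd.1
    · rw [← hd.2, hmom t h0]
      funext k
      simp only [moment, hcl t ht h0]
  obtain ⟨G', hG', hG'cl, hG'0, hG'β, hG's⟩ := hfam.exists_simple hβ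
    (hu.moment_closeUp_period hu.smoothG) hI hs hnull
  exact ⟨u, G', hu, hG', fun p hp => (hG'0 p hp).trans (closeUp_of_eq_zero hp),
    fun t ht h0 s => (hG'β t s h0).trans (hcl t ht h0 s), fun t ht => ⟨hG'cl t, hG's t ht⟩⟩

/-! ### Horizontal loops and plane curves -/

/-- The coordinates in which the Engel structure is `dm₁ = x dm₀`, `dm₂ = x² dm₀`. -/
noncomputable def lift (x : ℝ) (m : Fin 3 → ℝ) : R4 :=
  !₂[x, m 0, x * m 0 - m 1, (m 2 + x ^ 2 * m 0 - 2 * x * m 1) / 2]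

/-- The coordinates `m₀, m₁, m₂` of a point. -/
noncomputable def lowerM (p : R4) : Fin 3 → ℝ :=
  ![p 1, p 0 * p 1 - p 2, p 0 ^ 2 * p 1 - 2 * p 0 * p 2 + 2 * p 3]

theorem lift_lowerM (p : R4) : lift (p 0) (lowerM p) = p := by
  ext i
  fin_cases i <;> simp [lift, lowerM]
  ring

theorem lift_inj {x x' : ℝ} {m m' : Fin 3 → ℝ} (h : lift x m = lift x' m') :
    x = x' ∧ m = m' := by
  have h0 : x = x' := by simpa [lift] using congrArg (fun v : R4 => v 0) h
  have h1 : m 0 = m' 0 := by simpa [lift] using congrArg (fun v : R4 => v 1) h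
  have h2 : x * m 0 - m 1 = x' * m' 0 - m' 1 := by
    simpa [lift] using congrArg (fun v : R4 => v 2) h
  have h3 : (m 2 + x ^ 2 * m 0 - 2 * x * m 1) / 2 =
      (m' 2 + x' ^ 2 * m' 0 - 2 * x' * m' 1) / 2 := by
    simpa [lift] using congrArg (fun v : R4 => v 3) h
  subst h0
  have hm₁ : m 1 = m' 1 := by rw [h1] at h2; linarith
  have hm₂ : m 2 = m' 2 := by rw [h1, hm₁] at h3; linarith
  refine ⟨rfl, ?_⟩
  ext i
  fin_cases i
  exacts [h1, hm₁, hm₂]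

/-- The horizontal curves over a family of plane curves. -/
noncomputable def liftCurve (X G : ℝ × ℝ → ℝ) (b : ℝ → Fin 3 → ℝ) : ℝ × ℝ → R4 :=
  fun p => lift (X p) (b p.1 + moment X G p.1 0 p.2)

theorem contDiff_primitive_moment {X r : ℝ × ℝ → ℝ} (hX : ContDiff ℝ ∞ X)
    (hr : ContDiff ℝ ∞ r) : ContDiff ℝ ∞ fun p : ℝ × ℝ => moment X r p.1 0 p.2 := by
  have h : ContDiff ℝ ∞ fun p : ℝ × ℝ => (![p.1, 0, p.2] : Fin 3 → ℝ) := by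
    rw [contDiff_pi]
    intro i
    fin_cases i
    · exact contDiff_fst
    · exact contDiff_const
    · exact contDiff_snd
  exact (contDiff_moment hX hr).comp h

theorem contDiff_liftCurve {X G : ℝ × ℝ → ℝ} {b : ℝ → Fin 3 → ℝ} (hX : ContDiff ℝ ∞ X)
    (hG : ContDiff ℝ ∞ G) (hb : ContDiff ℝ ∞ b) : ContDiff ℝ ∞ (liftCurve X G b) := by
  have hm : ∀ k, ContDiff ℝ ∞ fun p : ℝ × ℝ => (b p.1 + moment X G p.1 0 p.2) k := fun k =>
    contDiff_pi.mp ((hb.comp contDiff_fst).add (contDiff_primitive_moment hX hG)) k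
  have h0 := hm 0
  have h1 := hm 1
  have h2 := hm 2
  rw [contDiff_euclidean]
  intro i
  fin_cases i <;> simp [liftCurve, lift] at h0 h1 h2 ⊢ <;> fun_prop

theorem hasDerivAt_moment {X r : ℝ × ℝ → ℝ} {t : ℝ} (hX : Continuous fun s => X (t, s))
    (hr : Continuous fun s => r (t, s)) (a s : ℝ) (k : Fin 3) :
    HasDerivAt (fun s => moment X r t a s k) (X (t, s) ^ (k : ℕ) * r (t, s)) s := by
  have hc : Continuous fun s => X (t, s) ^ (k : ℕ) * r (t, s) := (hX.pow _).mul hr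
  exact integral_hasDerivAt_right (hc.intervalIntegrable _ _)
    (hc.stronglyMeasurableAtFilter _ _) hc.continuousAt

theorem hasDerivAt_R4 {f : ℝ → R4} {v : R4} {s : ℝ}
    (h : ∀ i, HasDerivAt (fun s => f s i) (v i) s) : HasDerivAt f v s := by
  have h1 : HasDerivAt (fun s => WithLp.ofLp (f s)) (WithLp.ofLp v) s := hasDerivAt_pi.mpr h
  exact (PiLp.continuousLinearEquiv 2 ℝ (fun _ : Fin 4 => ℝ)).symm.hasFDerivAt.comp_hasDerivAt s h1

theorem hasDerivAt_apply_R4 {f : ℝ → R4} {v : R4} {s : ℝ} (h : HasDerivAt f v s) (i : Fin 4) :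
    HasDerivAt (fun s => f s i) (v i) s :=
  (EuclideanSpace.proj (𝕜 := ℝ) i).hasFDerivAt.comp_hasDerivAt s h

/-- Curves with dm₁ = x dm₀ and dm₂ = x² dm₀ are horizontal, with x' and m₀' as components of the
velocity in the frame. -/
theorem hasDerivAt_lift {x : ℝ → ℝ} {m : ℝ → Fin 3 → ℝ} {c g s : ℝ} (hx : HasDerivAt x c s)
    (hm : ∀ k : Fin 3, HasDerivAt (fun s => m s k) (x s ^ (k : ℕ) * g) s) :
    HasDerivAt (fun s => lift (x s) (m s))
      (c • e₁ (lift (x s) (m s)) + g • e₂ (lift (x s) (m s))) s := by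
  have h0 := hm 0
  have h1 := hm 1
  have h2 := hm 2
  simp only [Fin.val_zero, Fin.val_one, Fin.val_two, pow_zero, pow_one, one_mul] at h0 h1 h2
  refine hasDerivAt_R4 fun i => ?_
  fin_cases i
  · simpa [lift, e₁, e₂] using hx
  · simpa [lift, e₁, e₂] using h0
  · simp only [lift, e₁, e₂]
    refine HasDerivAt.congr_deriv ((hx.mul h0).sub h1) ?_
    simp
  · simp only [lift, e₁, e₂]
    refine HasDerivAt.congr_deriv
      (((h2.add ((hx.pow 2).mul h0)).sub ((hx.const_mul 2).mul h1)).div_const 2) ?_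
    simp
    ring

namespace IsFamily

variable {X C G : ℝ × ℝ → ℝ}

theorem hasDerivAt_liftCurve (h : IsFamily X C G) (b : ℝ → Fin 3 → ℝ) (t s : ℝ) :
    HasDerivAt (fun s => liftCurve X G b (t, s))
      (C (t, s) • e₁ (liftCurve X G b (t, s)) + G (t, s) • e₂ (liftCurve X G b (t, s))) s :=
  hasDerivAt_lift (x := fun s => X (t, s)) (m := fun s => b t + moment X G t 0 s) (h.deriv t s)
    fun k => (hasDerivAt_moment (continuous_slice h.smoothX t) (continuous_slice h.smoothG t) 0 s
      k).const_add (b t k)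

theorem liftCurve_periodic (h : IsFamily X C G) (b : ℝ → Fin 3 → ℝ) {t : ℝ}
    (hcl : moment X G t 0 1 = 0) : Function.Periodic (fun s => liftCurve X G b (t, s)) 1 := by
  intro s
  simp only [liftCurve, h.periodicX]
  rw [← moment_add_adjacent (continuous_slice h.smoothX t) (continuous_slice h.smoothG t) 0 s
    (s + 1), moment_period (h.periodicX t) (h.periodicG t), hcl, add_zero]

/-- Two parameters with the same image cut the circle into two arcs whose moments both vanish; the
shorter has length at most 1/2. -/
theorem liftCurve_injective (h : IsFamily X C G) (b : ℝ → Fin 3 → ℝ) {t : ℝ}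
    (hcl : moment X G t 0 1 = 0) (hs : IsSimple X G t) {a a' : ℝ}
    (heq : liftCurve X G b (t, a) = liftCurve X G b (t, a')) :
    (a : UnitAddCircle) = (a' : UnitAddCircle) := by
  have hper := h.liftCurve_periodic b hcl
  have hdouble : ∀ a a', liftCurve X G b (t, a) = liftCurve X G b (t, a') →
      IsDouble X G t a a' := by
    intro a a' heq
    obtain ⟨h1, h2⟩ := lift_inj heq
    refine ⟨h1, ?_⟩
    have h3 := moment_add_adjacent (continuous_slice h.smoothX t)
      (continuous_slice h.smoothG t) 0 a a'
    rw [← add_left_cancel h2] at h3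
    exact add_eq_left.mp h3
  obtain ⟨d, n, hd0, hd1, rfl⟩ : ∃ (d : ℝ) (n : ℤ), 0 ≤ d ∧ d < 1 ∧ a' = a + d + n :=
    ⟨Int.fract (a' - a), ⌊a' - a⌋, Int.fract_nonneg _, Int.fract_lt_one _, by
      linarith [Int.fract_add_floor (a' - a)]⟩
  have heq' : liftCurve X G b (t, a) = liftCurve X G b (t, a + d) := by
    rw [heq]
    simpa using hper.int_mul n (a + d)
  rcases hd0.eq_or_lt with rfl | hpos
  · rw [← sub_eq_zero, ← AddCircle.coe_sub, AddCircle.coe_eq_zero_iff]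
    exact ⟨-n, by simp⟩
  · exfalso
    by_cases hhalf : d ≤ 1 / 2
    · exact hs a (a + d) (by linarith) (by linarith) (hdouble _ _ heq')
    · refine hs (a + d) (a + 1) (by linarith) (by linarith) (hdouble _ _ ?_)
      rw [← heq']
      exact (hper a).symm

/-- The horizontal loop over a closed simple plane curve. -/
noncomputable def toLoop (h : IsFamily X C G) {b : ℝ → Fin 3 → ℝ} (hb : ContDiff ℝ ∞ b) (t : ℝ)
    (hcl : moment X G t 0 1 = 0) (hs : IsSimple X G t) : HorizontalLoop where
  toFun := (h.liftCurve_periodic b hcl).lift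
  smooth := (contDiff_liftCurve h.smoothX h.smoothG hb).comp
    (by fun_prop : ContDiff ℝ ∞ fun s : ℝ => (t, s))
  injective := by
    intro p q
    induction p using QuotientAddGroup.induction_on with | _ a
    induction q using QuotientAddGroup.induction_on with | _ a'
    exact h.liftCurve_injective b hcl hs
  immersion s := by
    rw [show velocity (h.liftCurve_periodic b hcl).lift s = _ from
      (h.hasDerivAt_liftCurve b t s).deriv]
    intro h0
    have h1 : C (t, s) = 0 := by simpa [e₁, e₂] using congrArg (fun v : R4 => v 0) h0
    have h2 : G (t, s) = 0 := by simpa [e₁, e₂] using congrArg (fun v : R4 => v 1) h0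
    exact (h.regular t s).elim (fun h => h h1) (fun h => h h2)
  horizontal s := by
    rw [show velocity (h.liftCurve_periodic b hcl).lift s = _ from
      (h.hasDerivAt_liftCurve b t s).deriv, distribution_eq_span]
    exact Submodule.mem_span_pair.mpr ⟨_, _, rfl⟩

theorem toLoop_apply (h : IsFamily X C G) {b : ℝ → Fin 3 → ℝ} (hb : ContDiff ℝ ∞ b) (t : ℝ)
    (hcl : moment X G t 0 1 = 0) (hs : IsSimple X G t) (s : ℝ) :
    (h.toLoop hb t hcl hs).toFun (s : UnitAddCircle) = liftCurve X G b (t, s) :=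
  rfl

theorem velocity_toLoop (h : IsFamily X C G) {b : ℝ → Fin 3 → ℝ} (hb : ContDiff ℝ ∞ b) (t : ℝ)
    (hcl : moment X G t 0 1 = 0) (hs : IsSimple X G t) (s : ℝ) :
    velocity (h.toLoop hb t hcl hs).toFun s 0 = C (t, s) ∧
      velocity (h.toLoop hb t hcl hs).toFun s 1 = G (t, s) := by
  rw [show velocity (h.toLoop hb t hcl hs).toFun s = _ from (h.hasDerivAt_liftCurve b t s).deriv]
  simp [e₁, e₂]

end IsFamily

/-! ### The plane curve of a horizontal loop. -/

namespace HorizontalLoop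

theorem ext_coe {γ γ' : HorizontalLoop}
    (h : ∀ s : ℝ, γ.toFun (s : UnitAddCircle) = γ'.toFun (s : UnitAddCircle)) : γ = γ' := by
  have h1 : γ.toFun = γ'.toFun := by
    funext p
    induction p using QuotientAddGroup.induction_on with | _ a
    exact h a
  cases γ
  cases γ'
  simpa using h1

theorem hasDerivAt (γ : HorizontalLoop) (s : ℝ) :
    HasDerivAt (fun s : ℝ => γ.toFun (s : UnitAddCircle)) (velocity γ.toFun s) s :=
  (γ.smooth.differentiable (by simp) s).hasDerivAt

theorem contDiff_velocity (γ : HorizontalLoop) : ContDiff ℝ ∞ (velocity γ.toFun) :=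
  (contDiff_infty_iff_deriv.mp γ.smooth).2

theorem contDiff_velocity_apply (γ : HorizontalLoop) (i : Fin 4) :
    ContDiff ℝ ∞ fun s => velocity γ.toFun s i :=
  contDiff_euclidean.mp γ.contDiff_velocity i

theorem apply_add_one (γ : HorizontalLoop) (s : ℝ) :
    γ.toFun ((s + 1 : ℝ) : UnitAddCircle) = γ.toFun (s : UnitAddCircle) := by
  rw [AddCircle.coe_add, AddCircle.coe_period, add_zero]

theorem velocity_ne_zero (γ : HorizontalLoop) (s : ℝ) :
    velocity γ.toFun s 0 ≠ 0 ∨ velocity γ.toFun s 1 ≠ 0 := by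
  by_contra! h
  apply γ.immersion s
  rw [eq_of_mem_distribution (γ.horizontal s), h.1, h.2]
  simp

/-- The converse of `hasDerivAt_lift`: horizontality gives dm₁ = x dm₀ and dm₂ = x² dm₀. -/
theorem hasDerivAt_lowerM (γ : HorizontalLoop) (s : ℝ) (k : Fin 3) :
    HasDerivAt (fun s : ℝ => lowerM (γ.toFun (s : UnitAddCircle)) k)
      (γ.toFun (s : UnitAddCircle) 0 ^ (k : ℕ) * velocity γ.toFun s 1) s := by
  have h0 := hasDerivAt_apply_R4 (γ.hasDerivAt s) 0
  have h1 := hasDerivAt_apply_R4 (γ.hasDerivAt s) 1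
  have h2 := hasDerivAt_apply_R4 (γ.hasDerivAt s) 2
  have h3 := hasDerivAt_apply_R4 (γ.hasDerivAt s) 3
  obtain ⟨e1, e2⟩ := γ.horizontal s
  fin_cases k
  · simpa [lowerM] using h1
  · refine HasDerivAt.congr_deriv ((h0.mul h1).sub h2) ?_
    simp
    linear_combination -e1
  · refine HasDerivAt.congr_deriv
      ((((h0.pow 2).mul h1).sub ((h0.const_mul 2).mul h2)).add (h3.const_mul 2)) ?_
    simp
    linear_combination 2 * e2 - 2 * γ.toFun (s : UnitAddCircle) 0 * e1

theorem moment_eq (γ : HorizontalLoop) {X G : ℝ × ℝ → ℝ} {t : ℝ}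
    (hX : ∀ s : ℝ, X (t, s) = γ.toFun (s : UnitAddCircle) 0)
    (hG : ∀ s, G (t, s) = velocity γ.toFun s 1) (a b : ℝ) :
    moment X G t a b =
      lowerM (γ.toFun (b : UnitAddCircle)) - lowerM (γ.toFun (a : UnitAddCircle)) := by
  funext k
  simp only [moment, hX, hG, Pi.sub_apply]
  refine integral_eq_sub_of_hasDerivAt
    (f := fun s : ℝ => lowerM (γ.toFun (s : UnitAddCircle)) k)
    (fun s _ => γ.hasDerivAt_lowerM s k) (Continuous.intervalIntegrable ?_ _ _)
  exact ((contDiff_euclidean.mp γ.smooth 0).continuous.pow _).mul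
    (γ.contDiff_velocity_apply 1).continuous

theorem moment_period (γ : HorizontalLoop) {X G : ℝ × ℝ → ℝ} {t : ℝ}
    (hX : ∀ s : ℝ, X (t, s) = γ.toFun (s : UnitAddCircle) 0)
    (hG : ∀ s, G (t, s) = velocity γ.toFun s 1) : moment X G t 0 1 = 0 := by
  rw [γ.moment_eq hX hG, sub_eq_zero]
  simpa using congrArg lowerM (γ.apply_add_one 0)

theorem isSimple (γ : HorizontalLoop) {X G : ℝ × ℝ → ℝ} {t : ℝ}
    (hX : ∀ s : ℝ, X (t, s) = γ.toFun (s : UnitAddCircle) 0)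
    (hG : ∀ s, G (t, s) = velocity γ.toFun s 1) : IsSimple X G t := by
  rintro a b hab hab' ⟨h1, h2⟩
  rw [γ.moment_eq hX hG, sub_eq_zero] at h2
  rw [hX, hX] at h1
  have h3 : γ.toFun (a : UnitAddCircle) = γ.toFun (b : UnitAddCircle) := by
    rw [← lift_lowerM (γ.toFun (a : UnitAddCircle)), ← lift_lowerM (γ.toFun (b : UnitAddCircle)),
      h1, h2]
  have h4 := γ.injective h3
  rw [AddCircle.coe_eq_coe_iff_of_mem_Ico (a := a) ⟨le_rfl, by linarith⟩
    ⟨hab.le, by linarith⟩] at h4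
  exact hab.ne h4

theorem liftCurve_eq (γ : HorizontalLoop) {X G : ℝ × ℝ → ℝ} {b : ℝ → Fin 3 → ℝ} {t : ℝ}
    (hX : ∀ s : ℝ, X (t, s) = γ.toFun (s : UnitAddCircle) 0)
    (hG : ∀ s, G (t, s) = velocity γ.toFun s 1)
    (hb : b t = lowerM (γ.toFun ((0 : ℝ) : UnitAddCircle))) (s : ℝ) :
    liftCurve X G b (t, s) = γ.toFun (s : UnitAddCircle) := by
  simp only [liftCurve, γ.moment_eq hX hG, hX, hb, add_sub_cancel, lift_lowerM]

/-- If x' vanished identically, y' would have no zero by immersivity, against Rolle's theorem for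
the periodic function y. -/
theorem exists_velocity_zero_ne (γ : HorizontalLoop) : ∃ s, velocity γ.toFun s 0 ≠ 0 := by
  by_contra! hcon
  obtain ⟨s, -, hs⟩ := exists_hasDerivAt_eq_zero (f := fun s : ℝ => γ.toFun (s : UnitAddCircle) 1)
    zero_lt_one (contDiff_euclidean.mp γ.smooth 1).continuous.continuousOn
    (by simpa using (congrArg (fun p : R4 => p 1) (γ.apply_add_one 0)).symm)
    (fun s _ => hasDerivAt_apply_R4 (γ.hasDerivAt s) 1)
  exact (γ.velocity_ne_zero s).elim (fun h => h (hcon s)) (fun h => h hs)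

end HorizontalLoop

/-! ### Degrees -/

/-- The map `f` winds `n` times around the origin on the unit interval. -/
def HasDegree (f : ℝ → ℂ) (n : ℤ) : Prop :=
  ∃ L : ℝ → ℂ, Continuous L ∧ (∀ s, f s = Complex.exp (L s)) ∧
    L 1 = L 0 + n * (2 * Real.pi * Complex.I)

/-- The difference is a continuous function with values in 2πiℤ, hence constant. -/
theorem sub_eq_sub_of_exp_eq_exp {A B : ℝ → ℂ} (hA : Continuous A) (hB : Continuous B)
    (h : ∀ s, Complex.exp (A s) = Complex.exp (B s)) (s s' : ℝ) : A s - B s = A s' - B s' := by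
  choose k hk using fun s => Complex.exp_eq_exp_iff_exists_int.mp (h s)
  have hkc : Continuous k := by
    have hr : Continuous fun s => (k s : ℝ) := by
      have : (fun s => (k s : ℝ)) = fun s => (A s - B s).im / (2 * Real.pi) := by
        funext s
        rw [hk s]
        simp
      rw [this]
      exact (Complex.continuous_im.comp (hA.sub hB)).div_const _
    exact Int.isClosedEmbedding_coe_real.isEmbedding.continuous_iff.mpr hr
  have hconst : k s = k s' := PreconnectedSpace.constant inferInstance hkc
  rw [hk s, hk s', hconst]
  ring

theorem HasDegree.unique {f : ℝ → ℂ} {n m : ℤ} (hn : HasDegree f n) (hm : HasDegree f m) :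
    n = m := by
  obtain ⟨A, hA, hfA, hA1⟩ := hn
  obtain ⟨B, hB, hfB, hB1⟩ := hm
  have h := sub_eq_sub_of_exp_eq_exp hA hB (fun s => (hfA s).symm.trans (hfB s)) 1 0
  rw [hA1, hB1] at h
  have h1 : (n : ℂ) * (2 * Real.pi * Complex.I) = m * (2 * Real.pi * Complex.I) := by
    linear_combination h
  have h2 := mul_right_cancel₀ Complex.two_pi_I_ne_zero h1
  exact_mod_cast h2

/-- Integrate the logarithmic derivative f'/f to obtain L; then f exp(-L) has derivative zero. -/
theorem exists_contDiff_log {f : ℝ → ℂ} (hf : ContDiff ℝ ∞ f) (h0 : ∀ s, f s ≠ 0) :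
    ∃ L : ℝ → ℂ, ContDiff ℝ ∞ L ∧ ∀ s, f s = Complex.exp (L s) := by
  have hf' := contDiff_infty_iff_deriv.mp hf
  let g : ℝ → ℂ := fun s => deriv f s / f s
  have hg : ContDiff ℝ ∞ g := by
    simp only [g, div_eq_mul_inv]
    exact hf'.2.mul (hf.inv h0)
  let L : ℝ → ℂ := fun s => Complex.log (f 0) + ∫ u in (0 : ℝ)..s, g u
  have hL : ∀ s, HasDerivAt L (g s) s := fun s =>
    (integral_hasDerivAt_right (hg.continuous.intervalIntegrable _ _)
      (hg.continuous.stronglyMeasurableAtFilter _ _) hg.continuous.continuousAt).const_add _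
  have hLs : ContDiff ℝ ∞ L := by
    refine contDiff_infty_iff_deriv.mpr ⟨fun s => (hL s).differentiableAt, ?_⟩
    rwa [show deriv L = g from funext fun s => (hL s).deriv]
  refine ⟨L, hLs, fun s => ?_⟩
  have hG : ∀ s, HasDerivAt (fun s => f s * Complex.exp (-L s)) 0 s := by
    intro s
    refine ((hf'.1 s).hasDerivAt.mul (hL s).neg.cexp).congr_deriv ?_
    have h3 : f s * g s = deriv f s := mul_div_cancel₀ _ (h0 s)
    linear_combination -Complex.exp (-L s) * h3
  have hconst := is_const_of_deriv_eq_zero (fun s => (hG s).differentiableAt)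
    (fun s => (hG s).deriv) s 0
  have h1 : f 0 * Complex.exp (-L 0) = 1 := by
    simp [L, Complex.exp_neg, Complex.exp_log (h0 0), h0 0]
  rw [h1, Complex.exp_neg] at hconst
  exact (mul_inv_eq_one₀ (Complex.exp_ne_zero _)).mp hconst

theorem hasDegree_of_log {f L : ℝ → ℂ} (hL : Continuous L) (hf : ∀ s, f s = Complex.exp (L s))
    (hper : f 1 = f 0) : ∃ n, HasDegree f n := by
  rw [hf, hf] at hper
  obtain ⟨n, hn⟩ := Complex.exp_eq_exp_iff_exists_int.mp hper
  exact ⟨n, L, hL, hf, hn⟩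

theorem log_add_one {f L : ℝ → ℂ} {n : ℤ} (hf : HasDegree f n) (hper : ∀ s, f (s + 1) = f s)
    (hL : Continuous L) (hfL : ∀ s, f s = Complex.exp (L s)) (s : ℝ) :
    L (s + 1) = L s + n * (2 * Real.pi * Complex.I) := by
  have h1 := sub_eq_sub_of_exp_eq_exp (A := fun s => L (s + 1)) (B := L) (by fun_prop) hL
    (fun s => by rw [← hfL, ← hfL, hper]) s 0
  obtain ⟨m, hm⟩ := Complex.exp_eq_exp_iff_exists_int.mp
    (show Complex.exp (L 1) = Complex.exp (L 0) by
      rw [← hfL, ← hfL]; simpa using hper 0)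
  have h2 : m = n := HasDegree.unique ⟨L, hL, hfL, hm⟩ hf
  subst h2
  simp only [zero_add] at h1
  linear_combination h1 + hm

/-- The quotient g/f stays in the right half-plane, so its principal logarithm is continuous and has
equal values at 0 and 1; adding it to a logarithm of f gives one of g. -/
theorem HasDegree.of_norm_sub_lt {f g : ℝ → ℂ} {n : ℤ} (hf : HasDegree f n) (hfc : Continuous f)
    (hg : Continuous g) (hf1 : f 1 = f 0) (hg1 : g 1 = g 0) (h0 : ∀ s, f s ≠ 0)
    (hlt : ∀ s, ‖g s - f s‖ < ‖f s‖) : HasDegree g n := by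
  obtain ⟨L, hL, hfL, hL1⟩ := hf
  have hre : ∀ s, 0 < (g s / f s).re := by
    intro s
    have h1 : ‖g s / f s - 1‖ < 1 := by
      rw [div_sub_one (h0 s), norm_div, div_lt_one (norm_pos_iff.mpr (h0 s))]
      exact hlt s
    have h2 := (Complex.abs_re_le_norm _).trans_lt h1
    rw [Complex.sub_re, Complex.one_re, abs_lt] at h2
    linarith [h2.1]
  refine ⟨fun s => L s + Complex.log (g s / f s), hL.add ?_, fun s => ?_, ?_⟩
  · exact (hg.div hfc h0).clog fun s => Or.inl (hre s)
  · have hne : g s / f s ≠ 0 := fun h => by simpa [h] using hre s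
    rw [Complex.exp_add, ← hfL, Complex.exp_log hne, mul_div_cancel₀ _ (h0 s)]
  · simp only [hf1, hg1, hL1]
    ring

/-- The degree is constant in a continuous family. -/
theorem hasDegree_of_homotopy {F : ℝ × ℝ → ℂ} (hF : Continuous F) (h0 : ∀ p, F p ≠ 0)
    (hper : ∀ t s, F (t, s + 1) = F (t, s)) (hdeg : ∀ t, ∃ n, HasDegree (fun s => F (t, s)) n)
    {n : ℤ} {t t' : ℝ} (hn : HasDegree (fun s => F (t, s)) n) :
    HasDegree (fun s => F (t', s)) n := by
  choose d hd using hdeg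
  have hFt : ∀ t, Continuous fun s => F (t, s) := fun t => hF.comp (by fun_prop)
  have h1 : ∀ t, F (t, 1) = F (t, 0) := fun t => by simpa using hper t 0
  have hloc : ∀ t₀, ∀ᶠ t in 𝓝 t₀, d t = d t₀ := by
    intro t₀
    have hev : ∀ᶠ t in 𝓝 t₀, ∀ s ∈ Icc (0 : ℝ) 1, ‖F (t, s) - F (t₀, s)‖ < ‖F (t₀, s)‖ := by
      refine isCompact_Icc.eventually_forall_of_forall_eventually fun s _ => ?_
      have hc1 : Continuous fun z : ℝ × ℝ => ‖F (z.1, z.2) - F (t₀, z.2)‖ := by fun_prop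
      have hc2 : Continuous fun z : ℝ × ℝ => ‖F (t₀, z.2)‖ := by fun_prop
      exact hc1.continuousAt.eventually_lt hc2.continuousAt (by simpa using h0 (t₀, s))
    filter_upwards [hev] with t ht
    refine (hd t).unique ((hd t₀).of_norm_sub_lt (hFt _) (hFt _) (h1 _) (h1 _) (fun s => h0 _) ?_)
    intro s
    have hfr : ∀ t, F (t, s) = F (t, Int.fract s) := fun t => by
      conv_lhs => rw [← Int.fract_add_floor s]
      have h2 := (show Function.Periodic (fun s => F (t, s)) 1 from hper t).int_mul ⌊s⌋ (Int.fract s)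
      rwa [mul_one] at h2
    rw [hfr t, hfr t₀]
    exact ht _ ⟨Int.fract_nonneg s, (Int.fract_lt_one s).le⟩
  have hc : Continuous d := continuous_iff_continuousAt.mpr fun t₀ =>
    (continuousAt_const (y := d t₀)).congr ((hloc t₀).mono fun t ht => ht.symm)
  have hconst : d t' = d t := PreconnectedSpace.constant inferInstance hc
  rw [hn.unique (hd t), ← hconst]
  exact hd t'

/-! ### The rotation number as a degree, and its invariance. -/

namespace HorizontalLoop

/-- The velocity in the frame `e₁, e₂`, as a complex number. -/
noncomputable def frame (γ : HorizontalLoop) (s : ℝ) : ℂ :=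
  velocity γ.toFun s 0 + velocity γ.toFun s 1 * Complex.I

theorem frame_re (γ : HorizontalLoop) (s : ℝ) : (γ.frame s).re = velocity γ.toFun s 0 := by
  simp [frame]

theorem frame_im (γ : HorizontalLoop) (s : ℝ) : (γ.frame s).im = velocity γ.toFun s 1 := by
  simp [frame]

theorem contDiff_frame (γ : HorizontalLoop) : ContDiff ℝ ∞ γ.frame :=
  (Complex.ofRealCLM.contDiff.comp (γ.contDiff_velocity_apply 0)).add
    ((Complex.ofRealCLM.contDiff.comp (γ.contDiff_velocity_apply 1)).mul contDiff_const)

theorem frame_ne_zero (γ : HorizontalLoop) (s : ℝ) : γ.frame s ≠ 0 := by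
  intro h
  rcases γ.velocity_ne_zero s with h0 | h0
  · exact h0 (by rw [← frame_re, h, Complex.zero_re])
  · exact h0 (by rw [← frame_im, h, Complex.zero_im])

theorem frame_add_one (γ : HorizontalLoop) (s : ℝ) : γ.frame (s + 1) = γ.frame s := by
  simp only [frame, velocity_add_one]

theorem rot_eq_of_hasDegree {γ : HorizontalLoop} {n : ℤ} (h : HasDegree γ.frame n) :
    rot γ = n := by
  obtain ⟨L, hL, hfL, hL1⟩ := h
  refine (hasRotationNumber_iff γ n).mp ⟨fun s => (L s).im,
    ⟨Complex.continuous_im.comp hL, fun s => ⟨Real.exp (L s).re, Real.exp_pos _, ?_⟩⟩, ?_⟩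
  · have hre : velocity γ.toFun s 0 = Real.exp (L s).re * Real.cos (L s).im := by
      rw [← frame_re, hfL, Complex.exp_re]
    have him : velocity γ.toFun s 1 = Real.exp (L s).re * Real.sin (L s).im := by
      rw [← frame_im, hfL, Complex.exp_im]
    conv_lhs => rw [eq_of_mem_distribution (γ.horizontal s), hre, him]
    rw [smul_add, smul_smul, smul_smul]
  · simp only [hL1]
    simp
    ring

theorem hasDegree_frame (γ : HorizontalLoop) : HasDegree γ.frame (rot γ) := by
  obtain ⟨L, hL, hfL⟩ := exists_contDiff_log γ.contDiff_frame γ.frame_ne_zero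
  obtain ⟨n, hn⟩ := hasDegree_of_log hL.continuous hfL (by simpa using γ.frame_add_one 0)
  rwa [rot_eq_of_hasDegree hn]

end HorizontalLoop

/-- The frame is a continuous family of nonvanishing loops in ℂ, so its degree is constant.
Smoothness is known only over [0, 1], hence the derivative within that strip, which gives joint
continuity of the velocity. -/
theorem rot_eq_of_horizontallyIsotopic {γ₀ γ₁ : HorizontalLoop} (h : HorizontallyIsotopic γ₀ γ₁) :
    rot γ₀ = rot γ₁ := by
  obtain ⟨Γ, hΓ, rfl, rfl⟩ := h
  let f : ℝ × ℝ → R4 := fun p => (Γ p.1).toFun (p.2 : UnitAddCircle)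
  let S : Set (ℝ × ℝ) := Icc (0 : ℝ) 1 ×ˢ univ
  have hS : UniqueDiffOn ℝ S := (uniqueDiffOn_Icc zero_lt_one).prod uniqueDiffOn_univ
  have hvel : ∀ p ∈ S, velocity (Γ p.1).toFun p.2 = fderivWithin ℝ f S p (0, 1) := by
    rintro ⟨t, s⟩ hp
    have h1 : HasFDerivWithinAt f (fderivWithin ℝ f S (t, s)) S (t, s) :=
      (hΓ.differentiableOn (by simp) (t, s) hp).hasFDerivWithinAt
    have h2 : HasDerivAt (fun s : ℝ => (t, s)) ((0 : ℝ), (1 : ℝ)) s :=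
      (hasDerivAt_const s t).prodMk (hasDerivAt_id s)
    have h3 := h1.comp_hasDerivAt s h2 (Eventually.of_forall fun s => ⟨hp.1, mem_univ _⟩)
    exact h3.deriv
  have hcont : ContinuousOn (fun p : ℝ × ℝ => velocity (Γ p.1).toFun p.2) S := by
    have h1 : ContinuousOn (fun p => fderivWithin ℝ f S p (0, 1)) S :=
      (hΓ.continuousOn_fderivWithin hS (by simp)).clm_apply continuousOn_const
    exact h1.congr hvel
  -- Clamping time to [0, 1] extends the family continuously to all of ℝ; here `π` is this
  -- retraction.
  let π : ℝ → ℝ := fun t => (projIcc (0 : ℝ) 1 zero_le_one t : ℝ)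
  have hπ : Continuous π := continuous_subtype_val.comp continuous_projIcc
  have hvc : Continuous fun p : ℝ × ℝ => velocity (Γ (π p.1)).toFun p.2 :=
    hcont.comp_continuous (by fun_prop : Continuous fun p : ℝ × ℝ => (π p.1, p.2))
      fun p => ⟨Subtype.prop _, mem_univ _⟩
  have hFc : Continuous fun p : ℝ × ℝ => (Γ (π p.1)).frame p.2 := by
    unfold HorizontalLoop.frame
    have h0 : ∀ i : Fin 4, Continuous fun p : ℝ × ℝ => velocity (Γ (π p.1)).toFun p.2 i :=
      fun i => (EuclideanSpace.proj (𝕜 := ℝ) i).continuous.comp hvc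
    exact (Complex.continuous_ofReal.comp (h0 0)).add
      ((Complex.continuous_ofReal.comp (h0 1)).mul continuous_const)
  have hd : HasDegree (fun s => (Γ (π 0)).frame s) (rot (Γ (π 0))) := (Γ (π 0)).hasDegree_frame
  have hd1 : HasDegree (fun s => (Γ (π 1)).frame s) (rot (Γ (π 0))) :=
    hasDegree_of_homotopy (F := fun p : ℝ × ℝ => (Γ (π p.1)).frame p.2) hFc
      (fun p => (Γ (π p.1)).frame_ne_zero p.2) (fun t s => (Γ (π t)).frame_add_one s)
      (fun t => ⟨_, (Γ (π t)).hasDegree_frame⟩) hd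
  have hπ0 : π 0 = 0 := by simp [π]
  have hπ1 : π 1 = 1 := by simp [π]
  have := HorizontalLoop.rot_eq_of_hasDegree hd1
  rw [hπ0, hπ1] at this
  exact this.symm

/-! ### Smooth paths of functions -/

/-- The functions `f` and `g` are joined by a smooth path of functions satisfying `S`, which is
constant before time `0` and after time `1`. -/
def SmoothlyJoined (S : (ℝ → ℂ) → Prop) (f g : ℝ → ℂ) : Prop :=
  ∃ F : ℝ × ℝ → ℂ, ContDiff ℝ ∞ F ∧ (∀ t, S fun s => F (t, s)) ∧
    (∀ t ≤ 0, ∀ s, F (t, s) = f s) ∧ ∀ t, 1 ≤ t → ∀ s, F (t, s) = g s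

namespace SmoothlyJoined

variable {S : (ℝ → ℂ) → Prop} {f g h : ℝ → ℂ}

/-- Reparametrizing time by a smooth step makes the path constant beyond its ends. -/
theorem of_path {F : ℝ × ℝ → ℂ} (hF : ContDiff ℝ ∞ F)
    (hS : ∀ t ∈ Icc (0 : ℝ) 1, S fun s => F (t, s)) :
    SmoothlyJoined S (fun s => F (0, s)) fun s => F (1, s) := by
  refine ⟨fun p => F (Real.smoothTransition p.1, p.2), ?_, fun t => hS _
    ⟨Real.smoothTransition.nonneg t, Real.smoothTransition.le_one t⟩, fun t ht s => ?_,
    fun t ht s => ?_⟩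
  · exact hF.comp ((Real.smoothTransition.contDiff.comp contDiff_fst).prodMk contDiff_snd)
  · simp only [Real.smoothTransition.zero_of_nonpos ht]
  · simp only [Real.smoothTransition.one_of_one_le ht]

theorem symm (H : SmoothlyJoined S f g) : SmoothlyJoined S g f := by
  obtain ⟨F, hF, hS, h0, h1⟩ := H
  refine ⟨fun p => F (1 - p.1, p.2), by fun_prop, fun t => hS (1 - t),
    fun t ht s => h1 (1 - t) (by linarith) s, fun t ht s => h0 (1 - t) (by linarith) s⟩

theorem trans (H : SmoothlyJoined S f g) (H' : SmoothlyJoined S g h) : SmoothlyJoined S f h := by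
  obtain ⟨F, hF, hS, h0, h1⟩ := H
  obtain ⟨F', hF', hS', h0', h1'⟩ := H'
  -- The concatenation is written as a sum minus the common middle function, which is visibly
  -- smooth. In each half of the time interval one path is constant and cancels against that
  -- function.
  have hleft : ∀ t ≤ (1 / 2 : ℝ), ∀ s,
      F (2 * t, s) + F' (2 * t - 1, s) - F (1, s) = F (2 * t, s) := by
    intro t ht s
    rw [h0' (2 * t - 1) (by linarith), h1 1 le_rfl]
    ring
  have hright : ∀ t, (1 / 2 : ℝ) ≤ t → ∀ s,
      F (2 * t, s) + F' (2 * t - 1, s) - F (1, s) = F' (2 * t - 1, s) := by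
    intro t ht s
    rw [h1 (2 * t) (by linarith), h1 1 le_rfl]
    ring
  refine ⟨fun p => F (2 * p.1, p.2) + F' (2 * p.1 - 1, p.2) - F (1, p.2), by fun_prop,
    fun t => ?_, fun t ht s => ?_, fun t ht s => ?_⟩
  · rcases le_total t (1 / 2) with ht | ht
    · simpa only [hleft t ht] using hS (2 * t)
    · simpa only [hright t ht] using hS' (2 * t - 1)
  · exact (hleft t (by linarith) s).trans (h0 _ (by linarith) s)
  · exact (hright t (by linarith) s).trans (h1' _ (by linarith) s)

end SmoothlyJoined

/-! ### Paths of logarithms -/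

/-- A logarithm of a loop of degree `n` whose real part takes both signs. -/
structure IsLog (n : ℤ) (L : ℝ → ℂ) : Prop where
  smooth : ContDiff ℝ ∞ L
  add_one : ∀ s, L (s + 1) = L s + n * (2 * Real.pi * Complex.I)
  turns : ∃ s₁ s₂ a, Real.cos a = 0 ∧ (L s₁).im < a ∧ a < (L s₂).im

theorem exists_cos_eq_zero_Ioo {x y : ℝ} (h : x + Real.pi < y) :
    ∃ a, Real.cos a = 0 ∧ x < a ∧ a < y := by
  have hpi := Real.pi_pos
  let k : ℤ := ⌊(x - Real.pi / 2) / Real.pi⌋ + 1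
  have h1 : (x - Real.pi / 2) / Real.pi < k := by
    simp [k]
  have h2 : (k : ℝ) ≤ (x - Real.pi / 2) / Real.pi + 1 := by
    simpa [k] using Int.floor_le ((x - Real.pi / 2) / Real.pi)
  rw [div_lt_iff₀ hpi] at h1
  rw [← sub_le_iff_le_add, le_div_iff₀ hpi] at h2
  refine ⟨(2 * k + 1) * Real.pi / 2, Real.cos_eq_zero_iff.mpr ⟨k, rfl⟩, ?_, ?_⟩ <;> nlinarith

/-- Zeros of the cosine are simple, so it changes sign at `a`; by continuity θ attains values on
both sides arbitrarily close to `a`. -/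
theorem exists_cos_pos_neg {θ : ℝ → ℝ} (hθ : Continuous θ) {s₁ s₂ a : ℝ} (ha : Real.cos a = 0)
    (h1 : θ s₁ < a) (h2 : a < θ s₂) : (∃ s, 0 < Real.cos (θ s)) ∧ ∃ s, Real.cos (θ s) < 0 := by
  obtain ⟨e, he0, he⟩ := exists_between
    (lt_min Real.pi_pos (lt_min (sub_pos.mpr h1) (sub_pos.mpr h2)))
  have e1 : e < Real.pi := he.trans_le (min_le_left _ _)
  have e2 : e < a - θ s₁ := he.trans_le ((min_le_right _ _).trans (min_le_left _ _))
  have e3 : e < θ s₂ - a := he.trans_le ((min_le_right _ _).trans (min_le_right _ _))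
  obtain ⟨p, hp⟩ := mem_range_of_exists_le_of_exists_ge (c := a + e) hθ ⟨s₁, by linarith⟩
    ⟨s₂, by linarith⟩
  obtain ⟨q, hq⟩ := mem_range_of_exists_le_of_exists_ge (c := a - e) hθ ⟨s₁, by linarith⟩
    ⟨s₂, by linarith⟩
  have hsin := Real.sin_pos_of_pos_of_lt_pi he0 e1
  have hcp : Real.cos (θ p) = -(Real.sin a * Real.sin e) := by rw [hp, Real.cos_add, ha]; ring
  have hcq : Real.cos (θ q) = Real.sin a * Real.sin e := by rw [hq, Real.cos_sub, ha]; ring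
  have hsa : Real.sin a ≠ 0 := fun h => by
    have := Real.sin_sq_add_cos_sq a
    rw [h, ha] at this
    norm_num at this
  rcases hsa.lt_or_gt with h | h
  · have := mul_neg_of_neg_of_pos h hsin
    exact ⟨⟨p, by linarith⟩, ⟨q, by linarith⟩⟩
  · have := mul_pos h hsin
    exact ⟨⟨q, by linarith⟩, ⟨p, by linarith⟩⟩

theorem exists_cos_eq_zero_between {x y : ℝ} (hx : 0 < Real.cos x) (hy : Real.cos y < 0) :
    ∃ a, Real.cos a = 0 ∧ min x y < a ∧ a < max x y := by
  have h0 : (0 : ℝ) ∈ uIcc (Real.cos x) (Real.cos y) := by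
    rw [uIcc_of_ge (hy.trans hx).le]
    exact ⟨hy.le, hx.le⟩
  obtain ⟨a, ha, ha0⟩ := intermediate_value_uIcc Real.continuous_cos.continuousOn h0
  have hax : a ≠ x := by rintro rfl; linarith
  have hay : a ≠ y := by rintro rfl; linarith
  refine ⟨a, ha0, lt_of_le_of_ne ha.1 ?_, lt_of_le_of_ne ha.2 ?_⟩
  · rcases min_choice x y with h | h <;> rw [h]
    exacts [hax.symm, hay.symm]
  · rcases max_choice x y with h | h <;> rw [h]
    exacts [hax, hay]

namespace IsLog

variable {n : ℤ} {L L' : ℝ → ℂ}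

theorem re_exp_pos_neg (h : IsLog n L) :
    (∃ s, 0 < (Complex.exp (L s)).re) ∧ ∃ s, (Complex.exp (L s)).re < 0 := by
  obtain ⟨s₁, s₂, a, ha, h1, h2⟩ := h.turns
  obtain ⟨⟨p, hp⟩, ⟨q, hq⟩⟩ := exists_cos_pos_neg
    (Complex.continuous_im.comp h.smooth.continuous) ha h1 h2
  refine ⟨⟨p, ?_⟩, ⟨q, ?_⟩⟩ <;> rw [Complex.exp_re]
  · exact mul_pos (Real.exp_pos _) hp
  · exact mul_neg_of_pos_of_neg (Real.exp_pos _) hq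

/-- The quasi-periodicity of logarithms survives convex combinations. An oscillation of more than π
in the imaginary part forces it across a zero of the cosine. -/
theorem smoothlyJoined_linear (h : IsLog n L) (h' : IsLog n L')
    (hosc : ∀ t ∈ Icc (0 : ℝ) 1, ∃ s₁ s₂, ((1 - t) * (L s₁).im + t * (L' s₁).im) + Real.pi <
      (1 - t) * (L s₂).im + t * (L' s₂).im) : SmoothlyJoined (IsLog n) L L' := by
  have hL := h.smooth
  have hL' := h'.smooth
  have key := SmoothlyJoined.of_path (S := IsLog n)
    (F := fun p : ℝ × ℝ => ((1 - p.1 : ℝ) : ℂ) * L p.2 + (p.1 : ℂ) * L' p.2) ?_ ?_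
  · simpa using key
  · have hof : ContDiff ℝ ∞ fun x : ℝ => (x : ℂ) := Complex.ofRealCLM.contDiff
    fun_prop
  · intro t ht
    refine ⟨((contDiff_const (c := ((1 - t : ℝ) : ℂ))).mul hL).add
      ((contDiff_const (c := (t : ℂ))).mul hL'), fun s => ?_, ?_⟩
    · rw [h.add_one, h'.add_one]
      push_cast
      ring
    · obtain ⟨s₁, s₂, hs⟩ := hosc t ht
      obtain ⟨a, ha, h1, h2⟩ := exists_cos_eq_zero_Ioo hs
      refine ⟨s₁, s₂, a, ha, ?_, ?_⟩ <;> simpa using by assumption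

/-- For n ≠ 0 the imaginary part changes by 2πn over a period, for every convex combination, and
2π|n| > π. -/
theorem smoothlyJoined_of_ne_zero (hn : n ≠ 0) (h : IsLog n L) (h' : IsLog n L') :
    SmoothlyJoined (IsLog n) L L' := by
  refine h.smoothlyJoined_linear h' fun t _ => ?_
  have e : ∀ {L : ℝ → ℂ}, IsLog n L → (L 1).im = (L 0).im + 2 * Real.pi * n := by
    intro L h
    have h1 := congrArg Complex.im (h.add_one 0)
    simp at h1
    linarith
  have hpi := Real.pi_pos
  rcases hn.lt_or_gt with hneg | hpos
  · refine ⟨1, 0, ?_⟩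
    have h1 : (n : ℝ) ≤ -1 := by exact_mod_cast Int.le_sub_one_of_lt hneg
    rw [e h, e h']
    nlinarith
  · refine ⟨0, 1, ?_⟩
    have h1 : (1 : ℝ) ≤ n := by exact_mod_cast hpos
    rw [e h, e h']
    nlinarith

/-- A periodic logarithm can be deformed so that its imaginary part oscillates much, starting from
its minimum. -/
theorem exists_smoothlyJoined_large (h : IsLog 0 L) :
    ∃ M, SmoothlyJoined (IsLog 0) L M ∧ IsLog 0 M ∧ (∀ s, (M 0).im ≤ (M s).im) ∧
      ∃ s, (M 0).im + 4 * Real.pi < (M s).im := by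
  have hpi := Real.pi_pos
  have hper : ∀ s, L (s + 1) = L s := fun s => by simpa using h.add_one s
  obtain ⟨s₁, s₂, a, ha, h1, h2⟩ := h.turns
  -- The imaginary part is stretched away from `a` by the factor 1 + tK, which keeps the crossing of
  -- `a`. At t = 1 the oscillation exceeds K((L s₂).im - (L s₁).im) = 5π.
  let K : ℝ := 5 * Real.pi / ((L s₂).im - (L s₁).im)
  have hK : 0 < K := div_pos (by positivity) (by linarith)
  have hL := h.smooth
  have him : ContDiff ℝ ∞ fun s => (L s).im := Complex.imCLM.contDiff.comp hL
  have hof : ContDiff ℝ ∞ fun x : ℝ => (x : ℂ) := Complex.ofRealCLM.contDiff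
  let F : ℝ × ℝ → ℂ := fun p => L p.2 + ((p.1 * K * ((L p.2).im - a) : ℝ) : ℂ) * Complex.I
  have hF : ContDiff ℝ ∞ F := by
    have h3 : ContDiff ℝ ∞ fun p : ℝ × ℝ => p.1 * K * ((L p.2).im - a) :=
      (contDiff_fst.mul contDiff_const).mul ((him.comp contDiff_snd).sub contDiff_const)
    exact (hL.comp contDiff_snd).add ((hof.comp h3).mul contDiff_const)
  have hFim : ∀ t s, (F (t, s)).im = (L s).im + t * K * ((L s).im - a) := fun t s => by
    simp [F]
  have hFlog : ∀ t ∈ Icc (0 : ℝ) 1, IsLog 0 fun s => F (t, s) := by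
    intro t ht
    refine ⟨hF.comp (by fun_prop : ContDiff ℝ ∞ fun s : ℝ => (t, s)), fun s => ?_,
      s₁, s₂, a, ha, ?_, ?_⟩
    · simp [F, hper]
    · rw [hFim]
      have : t * K * ((L s₁).im - a) ≤ 0 :=
        mul_nonpos_of_nonneg_of_nonpos (mul_nonneg ht.1 hK.le) (by linarith)
      linarith
    · rw [hFim]
      have : 0 ≤ t * K * ((L s₂).im - a) := mul_nonneg (mul_nonneg ht.1 hK.le) (by linarith)
      linarith
  have hj1 : SmoothlyJoined (IsLog 0) L fun s => F (1, s) := by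
    simpa [F] using SmoothlyJoined.of_path hF hFlog
  have hM := hFlog 1 (by simp)
  have hcont : Continuous fun s => (F (1, s)).im := Complex.continuous_im.comp hM.smooth.continuous
  have hFper : Function.Periodic (fun s => F (1, s)) 1 := fun s => by simp [F, hper]
  obtain ⟨c, -, hc⟩ := (isCompact_Icc (a := (0 : ℝ)) (b := 1)).exists_isMinOn
    (nonempty_Icc.mpr zero_le_one) hcont.continuousOn
  have hmin : ∀ s, (F (1, c)).im ≤ (F (1, s)).im := by
    intro s
    have h3 : F (1, s) = F (1, Int.fract s) := by
      conv_lhs => rw [← Int.fract_add_floor s]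
      simpa using hFper.int_mul ⌊s⌋ (Int.fract s)
    rw [h3]
    exact hc ⟨Int.fract_nonneg s, (Int.fract_lt_one s).le⟩
  -- Rotating the parameter circle moves the minimum to 0.
  have hj2 : SmoothlyJoined (IsLog 0) (fun s => F (1, s)) fun s => F (1, s + c) := by
    have key := SmoothlyJoined.of_path (S := IsLog 0) (F := fun p : ℝ × ℝ => F (1, p.2 + p.1 * c))
      (by fun_prop) fun t _ => ?_
    · simpa using key
    · obtain ⟨p, q, a', ha', hp, hq⟩ := hM.turns
      refine ⟨hF.comp (by fun_prop : ContDiff ℝ ∞ fun s : ℝ => ((1 : ℝ), s + t * c)), fun s => ?_,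
        p - t * c, q - t * c, a', ha', by simpa using hp, by simpa using hq⟩
      simpa [add_right_comm] using hFper (s + t * c)
  refine ⟨fun s => F (1, s + c), hj1.trans hj2, ?_, ?_, s₂ - c, ?_⟩
  · obtain ⟨G, -, hG, -, hG1⟩ := hj2
    simpa only [hG1 1 le_rfl] using hG 1
  · intro s
    simpa using hmin (s + c)
  · simp only [zero_add, sub_add_cancel]
    have h3 := hmin s₁
    rw [hFim 1 s₁] at h3
    rw [hFim 1 s₂]
    have h4 : K * ((L s₂).im - (L s₁).im) = 5 * Real.pi := div_mul_cancel₀ _ (by linarith)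
    nlinarith

/-- For n = 0 both logarithms are first made to oscillate by more than 4π above a minimum at 0. In a
convex combination the one of weight at least 1/2 contributes a rise of more than 2π from 0 to its
own high point, and the common position of the minima prevents the other from reducing it. -/
theorem smoothlyJoined (h : IsLog n L) (h' : IsLog n L') : SmoothlyJoined (IsLog n) L L' := by
  by_cases hn : n = 0
  · subst hn
    obtain ⟨M, hj, hM, hmin, p, hp⟩ := h.exists_smoothlyJoined_large
    obtain ⟨M', hj', hM', hmin', p', hp'⟩ := h'.exists_smoothlyJoined_large
    refine (hj.trans (hM.smoothlyJoined_linear hM' fun t ht => ?_)).trans hj'.symm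
    have hpi := Real.pi_pos
    rcases le_total t (1 / 2) with htt | htt
    · refine ⟨0, p, ?_⟩
      nlinarith [mul_nonneg ht.1 (sub_nonneg.mpr (hmin' p)),
        mul_pos (by linarith : 0 < 1 - t) (sub_pos.mpr hp)]
    · refine ⟨0, p', ?_⟩
      nlinarith [mul_nonneg (sub_nonneg.mpr ht.2) (sub_nonneg.mpr (hmin p')),
        mul_pos (by linarith : 0 < t) (sub_pos.mpr hp')]
  · exact smoothlyJoined_of_ne_zero hn h h'

end IsLog

/-! ### Paths of closed frames -/

/-- A nowhere vanishing loop of velocities, closing up in the `x`-direction. -/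
structure IsFrame (f : ℝ → ℂ) : Prop where
  smooth : ContDiff ℝ ∞ f
  add_one : ∀ s, f (s + 1) = f s
  ne_zero : ∀ s, f s ≠ 0
  integral_re : ∫ s in (0 : ℝ)..1, (f s).re = 0
  nonconst : ∃ s, (f s).re ≠ 0

theorem exists_mem_Icc_of_periodic {c : ℝ → ℝ} (hper : ∀ s, c (s + 1) = c s) (s : ℝ) :
    ∃ s' ∈ Icc (0 : ℝ) 1, c s' = c s := by
  refine ⟨Int.fract s, ⟨Int.fract_nonneg s, (Int.fract_lt_one s).le⟩, ?_⟩
  have h := (show Function.Periodic c 1 from hper).int_mul ⌊s⌋ (Int.fract s)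
  rw [mul_one, Int.fract_add_floor] at h
  exact h.symm

theorem exists_pos_of_integral_eq_zero {c : ℝ → ℝ} (hc : Continuous c)
    (hper : ∀ s, c (s + 1) = c s) (hintegral : ∫ s in (0 : ℝ)..1, c s = 0) (hne : ∃ s, c s ≠ 0) :
    ∃ s, 0 < c s := by
  by_contra! hcon
  obtain ⟨s, hs⟩ := hne
  obtain ⟨s', hs', he⟩ := exists_mem_Icc_of_periodic hper s
  have := intervalIntegral.integral_pos zero_lt_one (f := fun s => -c s) (by fun_prop)
    (fun s _ => by simpa using hcon s)
    ⟨s', hs', by simpa using lt_of_le_of_ne (hcon s') (by rwa [he])⟩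
  rw [intervalIntegral.integral_neg, hintegral] at this
  simp at this

theorem IsFrame.contDiff_re {f : ℝ → ℂ} (hf : IsFrame f) : ContDiff ℝ ∞ fun s => (f s).re :=
  Complex.reCLM.contDiff.comp hf.smooth

/-- A real part of mean zero that is not identically zero takes both signs, so between two such
parameters the imaginary part of L passes a zero of the cosine. -/
theorem IsFrame.isLog {f L : ℝ → ℂ} {n : ℤ} (hf : IsFrame f) (hn : HasDegree f n)
    (hL : ContDiff ℝ ∞ L) (hfL : ∀ s, f s = Complex.exp (L s)) : IsLog n L := by
  refine ⟨hL, log_add_one hn hf.add_one hL.continuous hfL, ?_⟩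
  have hc := hf.contDiff_re.continuous
  have hper : ∀ s, (f (s + 1)).re = (f s).re := fun s => by rw [hf.add_one]
  obtain ⟨p, hp⟩ := exists_pos_of_integral_eq_zero hc hper hf.integral_re hf.nonconst
  obtain ⟨q, hq⟩ := exists_pos_of_integral_eq_zero (c := fun s => -(f s).re) hc.neg
    (fun s => by rw [hper]) (by rw [intervalIntegral.integral_neg, hf.integral_re, neg_zero])
    (by simpa using hf.nonconst)
  rw [hfL, Complex.exp_re] at hp hq
  have hp' : 0 < Real.cos (L p).im := pos_of_mul_pos_right hp (Real.exp_pos _).le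
  have hq' : Real.cos (L q).im < 0 := by
    have := Real.exp_pos (L q).re
    by_contra! h
    linarith [mul_nonneg this.le h]
  obtain ⟨a, ha, h1, h2⟩ := exists_cos_eq_zero_between hp' hq'
  rcases le_total (L p).im (L q).im with h | h
  · rw [min_eq_left h] at h1
    rw [max_eq_right h] at h2
    exact ⟨p, q, a, ha, h1, h2⟩
  · rw [min_eq_right h] at h1
    rw [max_eq_left h] at h2
    exact ⟨q, p, a, ha, h1, h2⟩

/-- A positive weight `m`, depending smoothly on `c`, for which `m c` has mean zero. -/
noncomputable def balance (c : ℝ → ℝ) (s : ℝ) : ℝ :=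
  1 + (√((∫ σ in (0 : ℝ)..1, c σ) ^ 2 + 1) - ∫ σ in (0 : ℝ)..1, c σ) /
      (2 * ∫ σ in (0 : ℝ)..1, c σ * expNegInvGlue (c σ)) * expNegInvGlue (c s) +
    (√((∫ σ in (0 : ℝ)..1, c σ) ^ 2 + 1) + ∫ σ in (0 : ℝ)..1, c σ) /
      (2 * ∫ σ in (0 : ℝ)..1, -c σ * expNegInvGlue (-c σ)) * expNegInvGlue (-c s)

theorem mul_expNegInvGlue_nonneg (x : ℝ) : 0 ≤ x * expNegInvGlue x := by
  rcases le_total x 0 with h | h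
  · rw [expNegInvGlue.zero_of_nonpos h, mul_zero]
  · exact mul_nonneg h (expNegInvGlue.nonneg x)

theorem integral_mul_expNegInvGlue_pos {c : ℝ → ℝ} (hc : Continuous c)
    (hper : ∀ s, c (s + 1) = c s) (hpos : ∃ s, 0 < c s) :
    0 < ∫ s in (0 : ℝ)..1, c s * expNegInvGlue (c s) := by
  obtain ⟨s, hs⟩ := hpos
  obtain ⟨s', hs', he⟩ := exists_mem_Icc_of_periodic hper s
  have hη : Continuous expNegInvGlue := (expNegInvGlue.contDiff (n := 0)).continuous
  refine intervalIntegral.integral_pos zero_lt_one (by fun_prop)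
    (fun s _ => mul_expNegInvGlue_nonneg _) ⟨s', hs', ?_⟩
  rw [he]
  exact mul_pos hs (expNegInvGlue.pos_of_pos hs)

theorem balance_pos {c : ℝ → ℝ} (hc : Continuous c) (hper : ∀ s, c (s + 1) = c s)
    (hpos : ∃ s, 0 < c s) (hneg : ∃ s, c s < 0) (s : ℝ) : 0 < balance c s := by
  have h1 := integral_mul_expNegInvGlue_pos hc hper hpos
  have h2 := integral_mul_expNegInvGlue_pos (c := fun s => -c s) hc.neg
    (fun s => by rw [hper]) (by simpa using hneg)
  set k := ∫ σ in (0 : ℝ)..1, c σ with hk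
  have h3 : |k| ≤ √(k ^ 2 + 1) := by
    rw [← Real.sqrt_sq_eq_abs]
    exact Real.sqrt_le_sqrt (by linarith)
  have h4 := abs_le.mp h3
  have e1 := expNegInvGlue.nonneg (c s)
  have e2 := expNegInvGlue.nonneg (-c s)
  unfold balance
  rw [← hk]
  have e3 : 0 ≤ √(k ^ 2 + 1) - k := by linarith
  have e4 : 0 ≤ √(k ^ 2 + 1) + k := by linarith
  positivity

/-- With k = ∫ c, the two correction terms contribute (√(k² + 1) - k)/2 and -(√(k² + 1) + k)/2, in
total -k. Using √(k² + 1) instead of |k| keeps the coefficients nonnegative and smooth in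
parameters. -/
theorem integral_balance_mul {c : ℝ → ℝ} (hc : Continuous c) (hper : ∀ s, c (s + 1) = c s)
    (hpos : ∃ s, 0 < c s) (hneg : ∃ s, c s < 0) :
    ∫ s in (0 : ℝ)..1, balance c s * c s = 0 := by
  have h1 := integral_mul_expNegInvGlue_pos hc hper hpos
  have h2 := integral_mul_expNegInvGlue_pos (c := fun s => -c s) hc.neg
    (fun s => by rw [hper]) (by simpa using hneg)
  have hη : Continuous expNegInvGlue := (expNegInvGlue.contDiff (n := 0)).continuous
  set k := ∫ σ in (0 : ℝ)..1, c σ with hk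
  set P := ∫ σ in (0 : ℝ)..1, c σ * expNegInvGlue (c σ) with hP
  set N := ∫ σ in (0 : ℝ)..1, -c σ * expNegInvGlue (-c σ) with hN
  have h3 : ∀ s, balance c s * c s = c s +
      (√(k ^ 2 + 1) - k) / (2 * P) * (c s * expNegInvGlue (c s)) -
      (√(k ^ 2 + 1) + k) / (2 * N) * (-c s * expNegInvGlue (-c s)) := by
    intro s
    unfold balance
    rw [← hk, ← hP, ← hN]
    ring
  simp only [h3]
  rw [intervalIntegral.integral_sub, intervalIntegral.integral_add,
    intervalIntegral.integral_const_mul, intervalIntegral.integral_const_mul, ← hk, ← hP, ← hN]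
  · field_simp
    ring
  all_goals exact Continuous.intervalIntegrable (by fun_prop) _ _

theorem contDiff_balance {c : ℝ × ℝ → ℝ} (hc : ContDiff ℝ ∞ c)
    (hper : ∀ t s, c (t, s + 1) = c (t, s)) (hpos : ∀ t, ∃ s, 0 < c (t, s))
    (hneg : ∀ t, ∃ s, c (t, s) < 0) :
    ContDiff ℝ ∞ fun p : ℝ × ℝ => balance (fun s => c (p.1, s)) p.2 := by
  have hη : ContDiff ℝ ∞ expNegInvGlue := expNegInvGlue.contDiff
  have hk : ContDiff ℝ ∞ fun t => ∫ σ in (0 : ℝ)..1, c (t, σ) := contDiff_integral_unitInterval hc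
  have hP : ContDiff ℝ ∞ fun t => ∫ σ in (0 : ℝ)..1, c (t, σ) * expNegInvGlue (c (t, σ)) :=
    contDiff_integral_unitInterval (f := fun p => c p * expNegInvGlue (c p)) (by fun_prop)
  have hN : ContDiff ℝ ∞ fun t => ∫ σ in (0 : ℝ)..1, -c (t, σ) * expNegInvGlue (-c (t, σ)) :=
    contDiff_integral_unitInterval (f := fun p => -c p * expNegInvGlue (-c p)) (by fun_prop)
  have hP0 : ∀ t, 2 * ∫ σ in (0 : ℝ)..1, c (t, σ) * expNegInvGlue (c (t, σ)) ≠ 0 := fun t =>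
    (mul_pos two_pos (integral_mul_expNegInvGlue_pos (continuous_slice hc t) (hper t)
      (hpos t))).ne'
  have hN0 : ∀ t, 2 * ∫ σ in (0 : ℝ)..1, -c (t, σ) * expNegInvGlue (-c (t, σ)) ≠ 0 := fun t =>
    (mul_pos two_pos (integral_mul_expNegInvGlue_pos (c := fun s => -c (t, s))
      (continuous_slice hc t).neg (fun s => by rw [hper]) (by simpa using hneg t))).ne'
  have hsq : ContDiff ℝ ∞ fun t => √((∫ σ in (0 : ℝ)..1, c (t, σ)) ^ 2 + 1) :=
    ((hk.pow 2).add contDiff_const).sqrt fun t => by positivity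
  unfold balance
  refine (contDiff_const.add (ContDiff.mul ?_ ?_)).add (ContDiff.mul ?_ ?_)
  · exact ((hsq.sub hk).div (contDiff_const.mul hP) hP0).comp contDiff_fst
  · exact hη.comp hc
  · exact ((hsq.add hk).div (contDiff_const.mul hN) hN0).comp contDiff_fst
  · exact hη.comp hc.neg

/-- The frame with logarithm `L`, balanced so as to close up. -/
noncomputable def balancedFrame (L : ℝ → ℂ) (s : ℝ) : ℂ :=
  (balance (fun s => (Complex.exp (L s)).re) s : ℂ) * Complex.exp (L s)

theorem IsLog.exp_add_one {n : ℤ} {L : ℝ → ℂ} (h : IsLog n L) (s : ℝ) :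
    Complex.exp (L (s + 1)) = Complex.exp (L s) := by
  rw [h.add_one, Complex.exp_add, Complex.exp_int_mul_two_pi_mul_I, mul_one]

theorem contDiff_balancedFrame {n : ℤ} {F : ℝ × ℝ → ℂ} (hF : ContDiff ℝ ∞ F)
    (hlog : ∀ t, IsLog n fun s => F (t, s)) :
    ContDiff ℝ ∞ fun p : ℝ × ℝ => balancedFrame (fun s => F (p.1, s)) p.2 := by
  have hexp : ContDiff ℝ ∞ fun p => Complex.exp (F p) := hF.cexp
  have hc : ContDiff ℝ ∞ fun p => (Complex.exp (F p)).re := Complex.reCLM.contDiff.comp hexp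
  have hb := contDiff_balance hc (fun t s => by rw [(hlog t).exp_add_one])
    (fun t => (hlog t).re_exp_pos_neg.1) (fun t => (hlog t).re_exp_pos_neg.2)
  exact (Complex.ofRealCLM.contDiff.comp hb).mul hexp

theorem IsLog.balance_pos {n : ℤ} {L : ℝ → ℂ} (h : IsLog n L) (s : ℝ) :
    0 < balance (fun s => (Complex.exp (L s)).re) s :=
  Engel.balance_pos (c := fun s => (Complex.exp (L s)).re)
    (Complex.continuous_re.comp h.smooth.continuous.cexp)
    (fun s => by rw [h.exp_add_one]) h.re_exp_pos_neg.1 h.re_exp_pos_neg.2 s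

theorem balancedFrame_re (L : ℝ → ℂ) (s : ℝ) : (balancedFrame L s).re =
    balance (fun s => (Complex.exp (L s)).re) s * (Complex.exp (L s)).re := by
  rw [balancedFrame, Complex.re_ofReal_mul]

theorem IsLog.isFrame_balancedFrame {n : ℤ} {L : ℝ → ℂ} (h : IsLog n L) :
    IsFrame (balancedFrame L) where
  smooth := (contDiff_balancedFrame (n := n) (F := fun p => L p.2) (h.smooth.comp contDiff_snd)
    fun _ => h).comp (by fun_prop : ContDiff ℝ ∞ fun s : ℝ => ((0 : ℝ), s))
  add_one s := by simp only [balancedFrame, balance, h.exp_add_one]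
  ne_zero s := mul_ne_zero (by exact_mod_cast (h.balance_pos s).ne') (Complex.exp_ne_zero _)
  integral_re := by
    simp only [balancedFrame_re]
    exact integral_balance_mul (Complex.continuous_re.comp h.smooth.continuous.cexp)
      (fun s => by rw [h.exp_add_one]) h.re_exp_pos_neg.1 h.re_exp_pos_neg.2
  nonconst := by
    obtain ⟨s, hs⟩ := h.re_exp_pos_neg.1
    exact ⟨s, by rw [balancedFrame_re]; exact (mul_pos (h.balance_pos s) hs).ne'⟩

/-- The straight segment works: its members are positive multiples of `f`, hence nonvanishing, and
mean zero of the real part is a linear condition. -/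
theorem IsFrame.smoothlyJoined_balancedFrame {f L : ℝ → ℂ} {n : ℤ} (hf : IsFrame f)
    (hL : IsLog n L) (hfL : ∀ s, f s = Complex.exp (L s)) :
    SmoothlyJoined IsFrame f (balancedFrame L) := by
  have hb := hL.isFrame_balancedFrame
  have hof : ContDiff ℝ ∞ fun x : ℝ => (x : ℂ) := Complex.ofRealCLM.contDiff
  let F : ℝ × ℝ → ℂ := fun p => ((1 - p.1 : ℝ) : ℂ) * f p.2 + (p.1 : ℂ) * balancedFrame L p.2
  have hF : ContDiff ℝ ∞ F := by
    have := hf.smooth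
    have := hb.smooth
    fun_prop
  have hm : ∀ t s, F (t, s) =
      ((1 - t + t * balance (fun s => (Complex.exp (L s)).re) s : ℝ) : ℂ) * f s := by
    intro t s
    simp only [F, balancedFrame, hfL]
    push_cast
    ring
  have hpos : ∀ t ∈ Icc (0 : ℝ) 1, ∀ s,
      0 < 1 - t + t * balance (fun s => (Complex.exp (L s)).re) s := by
    intro t ht s
    have h1 := hL.balance_pos s
    rcases ht.1.eq_or_lt with rfl | h0
    · simp
    · have := mul_pos h0 h1
      linarith [ht.2]
  have key := SmoothlyJoined.of_path (S := IsFrame) hF fun t ht => ?_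
  · simpa [F] using key
  · refine ⟨hF.comp (by fun_prop : ContDiff ℝ ∞ fun s : ℝ => (t, s)), fun s => ?_, fun s => ?_,
      ?_, ?_⟩
    · simp only [F, hf.add_one, hb.add_one]
    · rw [hm]
      exact mul_ne_zero (by exact_mod_cast (hpos t ht s).ne') (hf.ne_zero s)
    · have hre : ∀ s, (F (t, s)).re = (1 - t) * (f s).re + t * (balancedFrame L s).re := fun s => by
        simp only [F, Complex.add_re, Complex.re_ofReal_mul]
      simp only [hre]
      rw [intervalIntegral.integral_add, intervalIntegral.integral_const_mul,
        intervalIntegral.integral_const_mul, hf.integral_re, hb.integral_re]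
      · simp
      · exact (continuous_const.mul hf.contDiff_re.continuous).intervalIntegrable _ _
      · exact (continuous_const.mul hb.contDiff_re.continuous).intervalIntegrable _ _
    · obtain ⟨s, hs⟩ := hf.nonconst
      refine ⟨s, ?_⟩
      rw [hm, Complex.re_ofReal_mul]
      exact mul_ne_zero (hpos t ht s).ne' hs

theorem IsLog.smoothlyJoined_balancedFrame {n : ℤ} {L L' : ℝ → ℂ} (h : IsLog n L)
    (h' : IsLog n L') : SmoothlyJoined IsFrame (balancedFrame L) (balancedFrame L') := by
  obtain ⟨F, hF, hlog, h0, h1⟩ := h.smoothlyJoined h'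
  refine ⟨fun p => balancedFrame (fun s => F (p.1, s)) p.2, contDiff_balancedFrame hF hlog,
    fun t => (hlog t).isFrame_balancedFrame, fun t ht s => ?_, fun t ht s => ?_⟩
  · simp only [funext (h0 t ht)]
  · simp only [funext (h1 t ht)]

/-- Frames of the same degree are joined by a path of frames. -/
theorem IsFrame.smoothlyJoined {f g : ℝ → ℂ} {n : ℤ} (hf : IsFrame f) (hg : IsFrame g)
    (hfn : HasDegree f n) (hgn : HasDegree g n) : SmoothlyJoined IsFrame f g := by
  obtain ⟨L, hL, hfL⟩ := exists_contDiff_log hf.smooth hf.ne_zero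
  obtain ⟨M, hM, hgM⟩ := exists_contDiff_log hg.smooth hg.ne_zero
  have hL' := hf.isLog hfn hL hfL
  have hM' := hg.isLog hgn hM hgM
  exact ((hf.smoothlyJoined_balancedFrame hL' hfL).trans
    (hL'.smoothlyJoined_balancedFrame hM')).trans (hg.smoothlyJoined_balancedFrame hM' hgM).symm

/-! ### The classification -/

theorem isFamily_of_isFrame {F : ℝ × ℝ → ℂ} (hF : ContDiff ℝ ∞ F)
    (hf : ∀ t, IsFrame fun s => F (t, s)) {x : ℝ → ℝ} (hx : ContDiff ℝ ∞ x) :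
    IsFamily (fun p => x p.1 + ∫ σ in (0 : ℝ)..p.2, (F (p.1, σ)).re) (fun p => (F p).re)
      (fun p => (F p).im) := by
  have hre : ContDiff ℝ ∞ fun p => (F p).re := Complex.reCLM.contDiff.comp hF
  have him : ContDiff ℝ ∞ fun p => (F p).im := Complex.imCLM.contDiff.comp hF
  have hper : ∀ t s, F (t, s + 1) = F (t, s) := fun t => (hf t).add_one
  have hc := fun t => continuous_slice hre t
  refine ⟨?_, hre, him, fun t s => ?_, fun t s => by simp only [hper],
    fun t s => by simp only [hper], fun t s => ?_, fun t s => ?_, fun t => (hf t).nonconst⟩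
  · refine (hx.comp contDiff_fst).add (contDiff_intervalIntegral
      (f := fun q : (ℝ × ℝ) × ℝ => (F (q.1.1, q.2)).re) (a := fun _ => 0) (b := fun p => p.2)
      ?_ contDiff_const contDiff_snd)
    exact hre.comp (by fun_prop : ContDiff ℝ ∞ fun q : (ℝ × ℝ) × ℝ => (q.1.1, q.2))
  · have hp : Function.Periodic (fun s => (F (t, s)).re) 1 := fun s => by simp only [hper]
    have h1 := hp.intervalIntegral_add_eq s 0
    rw [zero_add, (hf t).integral_re] at h1
    simp only
    rw [← integral_add_adjacent_intervals ((hc t).intervalIntegrable 0 s)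
      ((hc t).intervalIntegrable s (s + 1)), h1, add_zero]
  · exact (integral_hasDerivAt_right ((hc t).intervalIntegrable _ _)
      ((hc t).stronglyMeasurableAtFilter _ _) (hc t).continuousAt).const_add (x t)
  · by_contra! h
    exact (hf t).ne_zero s (Complex.ext h.1 h.2)

theorem HorizontalLoop.isFrame (γ : HorizontalLoop) : IsFrame γ.frame where
  smooth := γ.contDiff_frame
  add_one := γ.frame_add_one
  ne_zero := γ.frame_ne_zero
  integral_re := by
    simp only [frame_re]
    rw [integral_eq_sub_of_hasDerivAt (f := fun s : ℝ => γ.toFun (s : UnitAddCircle) 0)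
      (fun s _ => hasDerivAt_apply_R4 (γ.hasDerivAt s) 0)
      ((γ.contDiff_velocity_apply 0).continuous.intervalIntegrable _ _), sub_eq_zero]
    simpa using congrArg (fun p : R4 => p 0) (γ.apply_add_one 0)
  nonconst := by simpa only [frame_re] using γ.exists_velocity_zero_ne

theorem HorizontalLoop.integral_frame_re (γ : HorizontalLoop) (s : ℝ) :
    γ.toFun ((0 : ℝ) : UnitAddCircle) 0 + ∫ σ in (0 : ℝ)..s, (γ.frame σ).re =
      γ.toFun (s : UnitAddCircle) 0 := by
  simp only [frame_re]
  rw [integral_eq_sub_of_hasDerivAt (f := fun s : ℝ => γ.toFun (s : UnitAddCircle) 0)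
    (fun s _ => hasDerivAt_apply_R4 (γ.hasDerivAt s) 0)
    ((γ.contDiff_velocity_apply 0).continuous.intervalIntegrable _ _)]
  ring

/-- A path of frames between those of the two loops is integrated to a family of plane curves, which
is then perturbed into one with embedded lifts. -/
theorem horizontallyIsotopic_of_rot_eq {γ₀ γ₁ : HorizontalLoop} (h : rot γ₀ = rot γ₁) :
    HorizontallyIsotopic γ₀ γ₁ := by
  classical
  obtain ⟨F, hF, hframe, hF0, hF1⟩ := γ₀.isFrame.smoothlyJoined γ₁.isFrame γ₀.hasDegree_frame
    (h ▸ γ₁.hasDegree_frame)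
  let τ : ℝ → ℝ := Real.smoothTransition
  have hτ : ContDiff ℝ ∞ τ := Real.smoothTransition.contDiff
  have hτ0 : ∀ t ≤ 0, τ t = 0 := fun t ht => Real.smoothTransition.zero_of_nonpos ht
  have hτ1 : ∀ t, 1 ≤ t → τ t = 1 := fun t ht => Real.smoothTransition.one_of_one_le ht
  let p₀ := γ₀.toFun ((0 : ℝ) : UnitAddCircle)
  let p₁ := γ₁.toFun ((0 : ℝ) : UnitAddCircle)
  -- The frames determine velocities only, so the coordinates of the base points are interpolated
  -- separately.
  let x : ℝ → ℝ := fun t => (1 - τ t) * p₀ 0 + τ t * p₁ 0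
  let b : ℝ → Fin 3 → ℝ := fun t => (1 - τ t) • lowerM p₀ + τ t • lowerM p₁
  have hx : ContDiff ℝ ∞ x := by fun_prop
  have hb : ContDiff ℝ ∞ b := by fun_prop
  let X : ℝ × ℝ → ℝ := fun p => x p.1 + ∫ σ in (0 : ℝ)..p.2, (F (p.1, σ)).re
  let C : ℝ × ℝ → ℝ := fun p => (F p).re
  let G : ℝ × ℝ → ℝ := fun p => (F p).im
  have hfam : IsFamily X C G := isFamily_of_isFrame hF hframe hx
  have hX0 : ∀ s : ℝ, X (0, s) = γ₀.toFun (s : UnitAddCircle) 0 := fun s => by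
    simpa [X, x, hτ0 0 le_rfl, hF0 0 le_rfl, p₀] using γ₀.integral_frame_re s
  have hX1 : ∀ s : ℝ, X (1, s) = γ₁.toFun (s : UnitAddCircle) 0 := fun s => by
    simpa [X, x, hτ1 1 le_rfl, hF1 1 le_rfl, p₁] using γ₁.integral_frame_re s
  have hG0 : ∀ s, G (0, s) = velocity γ₀.toFun s 1 := fun s => by
    simp [G, hF0 0 le_rfl, HorizontalLoop.frame_im]
  have hG1 : ∀ s, G (1, s) = velocity γ₁.toFun s 1 := fun s => by
    simp [G, hF1 1 le_rfl, HorizontalLoop.frame_im]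
  -- Within [0, 1] this vanishes exactly at the two ends, where the family consists of the given
  -- loops and must not be changed.
  let β : ℝ → ℝ := fun t => τ t * (1 - τ t)
  have hβ : ContDiff ℝ ∞ β := by fun_prop
  have hβ0 : β 0 = 0 := by simp [β, hτ0 0 le_rfl]
  have hβ1 : β 1 = 0 := by simp [β, hτ1 1 le_rfl]
  have hβne : ∀ t ∈ Icc (0 : ℝ) 1, β t = 0 → t = 0 ∨ t = 1 := by
    intro t ht h0
    rcases ht.1.eq_or_lt with h1 | h1
    · exact Or.inl h1.symm
    rcases ht.2.eq_or_lt with h2 | h2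
    · exact Or.inr h2
    have e1 : 0 < τ t := Real.smoothTransition.pos_of_pos h1
    have e2 : τ t < 1 := Real.smoothTransition.lt_one_of_lt_one h2
    exact absurd h0 (mul_pos e1 (by linarith)).ne'
  have hclamp : ∀ t, ∃ t' ∈ Icc (0 : ℝ) 1, β t = β t' ∧
      ∀ s, C (t, s) = C (t', s) ∧ G (t, s) = G (t', s) := by
    intro t
    rcases le_total t 0 with h0 | h0
    · refine ⟨0, by simp, by simp [β, hτ0 t h0, hτ0 0 le_rfl], fun s => ?_⟩
      simp [C, G, hF0 t h0, hF0 0 le_rfl]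
    rcases le_total 1 t with h1 | h1
    · refine ⟨1, by simp, by simp [β, hτ1 t h1, hτ1 1 le_rfl], fun s => ?_⟩
      simp [C, G, hF1 t h1, hF1 1 le_rfl]
    · exact ⟨t, ⟨h0, h1⟩, rfl, fun s => ⟨rfl, rfl⟩⟩
  obtain ⟨u, G', -, hfam', -, hG', hemb⟩ := hfam.exists_embedded hβ hclamp
    (isCompact_Icc (a := (0 : ℝ)) (b := 1)) (by
      intro t ht h0
      rcases hβne t ht h0 with rfl | rfl
      · exact ⟨γ₀.moment_period hX0 hG0, γ₀.isSimple hX0 hG0⟩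
      · exact ⟨γ₁.moment_period hX1 hG1, γ₁.isSimple hX1 hG1⟩)
  let Γ : ℝ → HorizontalLoop := fun t =>
    if ht : t ∈ Icc (0 : ℝ) 1 then hfam'.toLoop hb t (hemb t ht).1 (hemb t ht).2 else γ₀
  have hΓ : ∀ t ∈ Icc (0 : ℝ) 1, ∀ s : ℝ, (Γ t).toFun (s : UnitAddCircle) =
      liftCurve (sineShift X β u) G' b (t, s) := by
    intro t ht s
    simp only [Γ, dif_pos ht]
    exact hfam'.toLoop_apply hb t _ _ s
  have h0 : (0 : ℝ) ∈ Icc (0 : ℝ) 1 := by simp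
  have h1 : (1 : ℝ) ∈ Icc (0 : ℝ) 1 := by simp
  refine ⟨Γ, ?_, HorizontalLoop.ext_coe fun s => ?_, HorizontalLoop.ext_coe fun s => ?_⟩
  · exact (contDiff_liftCurve hfam'.smoothX hfam'.smoothG hb).contDiffOn.congr
      fun p hp => hΓ p.1 hp.1 p.2
  · rw [hΓ 0 h0]
    refine γ₀.liftCurve_eq (fun s => ?_) (fun s => ?_) ?_ s
    · simp [sineShift, hβ0, hX0]
    · rw [hG' 0 h0 hβ0, hG0]
    · simp [b, hτ0 0 le_rfl, p₀]
  · rw [hΓ 1 h1]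
    refine γ₁.liftCurve_eq (fun s => ?_) (fun s => ?_) ?_ s
    · simp [sineShift, hβ1, hX1]
    · rw [hG' 1 h1 hβ1, hG1]
    · simp [b, hτ1 1 le_rfl, p₁]

/-! ### Realizing every integer. -/

theorem hasDegree_of_smooth_homotopy {C G : ℝ × ℝ → ℝ} (hC : ContDiff ℝ ∞ C)
    (hG : ContDiff ℝ ∞ G) (h0 : ∀ t s, C (t, s) ≠ 0 ∨ G (t, s) ≠ 0)
    (hCper : ∀ t s, C (t, s + 1) = C (t, s)) (hGper : ∀ t s, G (t, s + 1) = G (t, s)) {n : ℤ}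
    {t t' : ℝ} (hn : HasDegree (fun s => C (t, s) + G (t, s) * Complex.I) n) :
    HasDegree (fun s => C (t', s) + G (t', s) * Complex.I) n := by
  let F : ℝ × ℝ → ℂ := fun p => C p + G p * Complex.I
  have hF : ContDiff ℝ ∞ F := (Complex.ofRealCLM.contDiff.comp hC).add
    ((Complex.ofRealCLM.contDiff.comp hG).mul contDiff_const)
  have hne : ∀ p, F p ≠ 0 := fun p hp => by
    rcases h0 p.1 p.2 with h | h
    · exact h (by simpa [F] using congrArg Complex.re hp)
    · exact h (by simpa [F] using congrArg Complex.im hp)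
  have hper : ∀ t s, F (t, s + 1) = F (t, s) := fun t s => by simp only [F, hCper, hGper]
  refine hasDegree_of_homotopy hF.continuous hne hper (fun t => ?_) hn
  obtain ⟨L, hL, hfL⟩ := exists_contDiff_log (f := fun s => F (t, s))
    (hF.comp (by fun_prop : ContDiff ℝ ∞ fun s : ℝ => (t, s))) fun s => hne _
  exact hasDegree_of_log hL.continuous hfL (by simpa using hper t 0)

theorem IsLog.hasDegree_balancedFrame {n : ℤ} {L : ℝ → ℂ} (h : IsLog n L) :
    HasDegree (balancedFrame L) n := by
  have hf := h.isFrame_balancedFrame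
  let m : ℝ → ℝ := balance fun s => (Complex.exp (L s)).re
  -- Expressing the weight as a quotient of norms derives its continuity from the smoothness of the
  -- balanced frame.
  have hm : ∀ s, m s = ‖balancedFrame L s‖ / Real.exp (L s).re := fun s => by
    rw [balancedFrame, norm_mul, Complex.norm_exp, Complex.norm_real, Real.norm_eq_abs,
      abs_of_pos (h.balance_pos s), mul_div_cancel_right₀ _ (Real.exp_pos _).ne']
  have hmc : Continuous m := by
    rw [funext hm]
    exact hf.smooth.continuous.norm.div
      (Complex.continuous_re.comp h.smooth.continuous).rexp fun s => (Real.exp_pos _).ne'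
  have hm1 : m 1 = m 0 := by
    have : m (0 + 1) = m 0 := by simp only [m, balance, h.exp_add_one]
    simpa using this
  refine ⟨fun s => (Real.log (m s) : ℂ) + L s, ?_, fun s => ?_, ?_⟩
  · exact (Complex.continuous_ofReal.comp (hmc.log fun s => (h.balance_pos s).ne')).add
      h.smooth.continuous
  · rw [Complex.exp_add, ← Complex.ofReal_exp, Real.exp_log (h.balance_pos s)]
    rfl
  · have h1 := h.add_one 0
    rw [zero_add] at h1
    simp only [hm1, h1]
    ring

/-- A linear angle plus a large sine. From -1/4 to 1/4 the sine term rises by 2π(|n| + 1) while the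
linear term changes by πn, so the net rise exceeds π even for n ≤ 0. -/
theorem exists_isLog (n : ℤ) : ∃ L, IsLog n L := by
  have hof : ContDiff ℝ ∞ fun x : ℝ => (x : ℂ) := Complex.ofRealCLM.contDiff
  let θ : ℝ → ℝ := fun s =>
    2 * Real.pi * n * s + Real.pi * (|n| + 1) * Real.sin (2 * Real.pi * s)
  have hθ : ContDiff ℝ ∞ θ := by fun_prop
  have hpi := Real.pi_pos
  have hlt : θ (-(1 / 4)) + Real.pi < θ (1 / 4) := by
    have e1 : Real.sin (2 * Real.pi * (1 / 4)) = 1 := by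
      rw [show 2 * Real.pi * (1 / 4) = Real.pi / 2 by ring, Real.sin_pi_div_two]
    have e2 : Real.sin (2 * Real.pi * -(1 / 4)) = -1 := by
      rw [show 2 * Real.pi * -(1 / 4) = -(2 * Real.pi * (1 / 4)) by ring, Real.sin_neg, e1]
    simp only [θ, e1, e2]
    have h1 := neg_abs_le (n : ℝ)
    have h2 := abs_nonneg (n : ℝ)
    push_cast
    nlinarith
  obtain ⟨a, ha, h1, h2⟩ := exists_cos_eq_zero_Ioo hlt
  refine ⟨fun s => (θ s : ℂ) * Complex.I, (hof.comp hθ).mul contDiff_const, fun s => ?_,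
    -(1 / 4), 1 / 4, a, ha, by simpa using h1, by simpa using h2⟩
  have : θ (s + 1) = θ s + 2 * Real.pi * n := by
    simp only [θ, mul_add, mul_one, Real.sin_add_two_pi]
    ring
  rw [this]
  push_cast
  ring

theorem exists_rot_eq (n : ℤ) : ∃ γ : HorizontalLoop, rot γ = n := by
  obtain ⟨L, hL⟩ := exists_isLog n
  let f := balancedFrame L
  have hf : IsFrame f := hL.isFrame_balancedFrame
  let C : ℝ × ℝ → ℝ := fun p => (f p.2).re
  let G : ℝ × ℝ → ℝ := fun p => (f p.2).im
  have hfam : IsFamily (fun p => (0 : ℝ) + ∫ σ in (0 : ℝ)..p.2, (f σ).re) C G :=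
    isFamily_of_isFrame (F := fun p => f p.2) (x := fun _ => 0) (hf.smooth.comp contDiff_snd)
      (fun _ => hf) contDiff_const
  -- The constant family is left unshifted at time 0 and perturbed at time 1. Only time 1 has to
  -- become embedded, and β ≠ 0 there, so nothing needs to be embedded beforehand.
  let β : ℝ → ℝ := Real.smoothTransition
  have hβ0 : β 0 = 0 := Real.smoothTransition.zero
  have hβ1 : β 1 = 1 := Real.smoothTransition.one
  obtain ⟨u, G', hu, hu', hG', -, hemb⟩ := hfam.exists_embedded (β := β)
    Real.smoothTransition.contDiff (I := {1}) (fun t => by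
      rcases le_total t 0 with h0 | h0
      · exact ⟨0, by simp, by simp [β, Real.smoothTransition.zero_of_nonpos h0],
          fun s => ⟨rfl, rfl⟩⟩
      rcases le_total 1 t with h1 | h1
      · exact ⟨1, by simp, by simp [β, Real.smoothTransition.one_of_one_le h1],
          fun s => ⟨rfl, rfl⟩⟩
      · exact ⟨t, ⟨h0, h1⟩, rfl, fun s => ⟨rfl, rfl⟩⟩)
    isCompact_singleton (by
      rintro t rfl h0
      rw [hβ1] at h0
      exact absurd h0 one_ne_zero)
  set C' := sineShiftDeriv C β u
  obtain ⟨hcl, hs⟩ := hemb 1 rfl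
  refine ⟨hu'.toLoop (b := fun _ => 0) contDiff_const 1 hcl hs,
    HorizontalLoop.rot_eq_of_hasDegree ?_⟩
  have hd0 : HasDegree (fun s => C' (0, s) + G (0, s) * Complex.I) n := by
    convert hL.hasDegree_balancedFrame using 1
    funext s
    simp [C', sineShiftDeriv, hβ0, C, G, f]
  have hd1 : HasDegree (fun s => C' (1, s) + G (1, s) * Complex.I) n :=
    hasDegree_of_smooth_homotopy hu.smoothC hu.smoothG hu.regular hu.periodicC hu.periodicG hd0
  -- The degree passes from G to G' along a segment at time 1. The velocity stays nonzero on the way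
  -- because G' = G wherever C' = 0.
  let H : ℝ × ℝ → ℝ := fun p => G (1, p.2) + p.1 * (G' (1, p.2) - G (1, p.2))
  have hH : ContDiff ℝ ∞ H := by
    have := hu.smoothG
    have := hu'.smoothG
    fun_prop
  have hslide : ContDiff ℝ ∞ fun p : ℝ × ℝ => C' (1, p.2) :=
    hu.smoothC.comp (by fun_prop : ContDiff ℝ ∞ fun p : ℝ × ℝ => ((1 : ℝ), p.2))
  have hd2 := hasDegree_of_smooth_homotopy (C := fun p => C' (1, p.2)) (G := H) hslide hH
    (fun t s => ?_) (fun t s => hu.periodicC 1 s)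
    (fun t s => by simp only [H, hu.periodicG, hu'.periodicG]) (t := 0) (t' := 1) (n := n)
    (by simpa [H] using hd1)
  · convert hd2 using 1
    funext s
    obtain ⟨h1, h2⟩ := hu'.velocity_toLoop (b := fun _ => 0) contDiff_const 1 hcl hs s
    rw [HorizontalLoop.frame, h1, h2]
    simp [H]
  · by_cases hc : C' (1, s) = 0
    · right
      simp only [H, hG' (1, s) hc, sub_self, mul_zero, add_zero]
      exact (hu.regular 1 s).resolve_left (not_not.mpr hc)
    · exact Or.inl hc

end Engel

theorem mainTheorem1 :
    (∀ γ₀ γ₁ : Engel.HorizontalLoop,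
      Engel.HorizontallyIsotopic γ₀ γ₁ ↔ Engel.rot γ₀ = Engel.rot γ₁) ∧
    (∀ n : ℤ, ∃ γ : Engel.HorizontalLoop, Engel.rot γ = n) := by
  exact ⟨fun _ _ => ⟨Engel.rot_eq_of_horizontallyIsotopic, Engel.horizontallyIsotopic_of_rot_eq⟩,
    Engel.exists_rot_eq⟩
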